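/- By a weight we mean a function $w\in L^1(\mathbb R)$ with $w(t)>0$ for almost every $t\in\mathbb R$. For a weight $w$, let $L^2_w(\mathbb R)$ be the Hilbert space of (classes of) measurable functions $f:\mathbb R\to\mathbb C$ with $\|f\|_{L^2_w}^2=\int_{\mathbb R}|f(t)|^2w(t)\,dt<\infty$, with scalar product $\langle f,g\rangle=\int_{\mathbb R}f(t)\overline{g(t)}\,w(t)\,dt$. **Theorem.** For every weight $w_0$ there are a weight $w$ with $w(t)\le w_0(t)$ for almost every $t$, a sequence of real numbers $\lambda_1<\lambda_2<\cdots$ that is uniformly discrete, i.e. $\inf_{n\ne m}|\lambda_m-\lambda_n|>0$, and a sequence of functions $e_1^*,e_2^*,\dots\in L^2_w(\mathbb R)$ such that every $f\in L^2_w(\mathbb R)$ admits the series expansion $$f(t)=\sum_{j=1}^{\infty}\langle f,e_j^*\rangle\,e^{2\pi i\lambda_j t},$$ where the partial sums $\sum_{j=1}^{N}$ converge to $f$ in the norm of $L^2_w(\mathbb R)$ as $N\to\infty$. -/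

import Mathlib

open MeasureTheory Filter Topology
open scoped ComplexConjugate ENNReal

/-- A weight on `ℝ`: an integrable function that is positive almost everywhere. -/
def IsWeight (w : ℝ → ℝ) : Prop :=
  Integrable w ∧ ∀ᵐ t : ℝ, 0 < w t

/-- The measure `w(t) dt`. -/
noncomputable def weightMeasure (w : ℝ → ℝ) : Measure ℝ :=
  volume.withDensity (fun t => ENNReal.ofReal (w t))

/-- `f` belongs to the weighted space `L²_w(ℝ)` of complex-valued functions. -/
def MemWeightedL2 (w : ℝ → ℝ) (f : ℝ → ℂ) : Prop :=
  MemLp f 2 (weightMeasure w)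

/-- The norm `(∫ |f(t)|² w(t) dt)^(1/2)` of `L²_w(ℝ)`, with values in `[0, ∞]`. -/
noncomputable def weightedL2Norm (w : ℝ → ℝ) (f : ℝ → ℂ) : ℝ≥0∞ :=
  eLpNorm f 2 (weightMeasure w)

/-- The scalar product `⟨f, g⟩ = ∫ f(t) conj(g(t)) w(t) dt` of `L²_w(ℝ)`. -/
noncomputable def weightedInner (w : ℝ → ℝ) (f g : ℝ → ℂ) : ℂ :=
  ∫ t : ℝ, f t * conj (g t) * (w t : ℂ)

/-- The exponential `t ↦ e^{2πiλt}`. -/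
noncomputable def expFun (lam : ℝ) (t : ℝ) : ℂ :=
  Complex.exp (2 * (Real.pi : ℂ) * Complex.I * (lam : ℂ) * (t : ℂ))

/-- The infimum of `|λ_m - λ_n|` over `n ≠ m` is positive. -/
def UniformlyDiscrete (lam : ℕ → ℝ) : Prop :=
  ∃ δ : ℝ, 0 < δ ∧ ∀ n m : ℕ, n ≠ m → δ ≤ |lam m - lam n|

open Polynomial in
/-- A function holomorphic on a closed disc of radius `R > 1` is uniformly approximable on the closed
unit disc by polynomials with the same constant term. -/
theorem exists_polynomial_approx_of_differentiableOn {f : ℂ → ℂ} {R : NNReal} (hR : 1 < R)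
    (hf : DifferentiableOn ℂ f (Metric.closedBall 0 R)) {ε : ℝ} (hε : 0 < ε) :
    ∃ P : ℂ[X], P.coeff 0 = f 0 ∧ ∀ z : ℂ, ‖z‖ ≤ 1 → ‖f z - P.eval z‖ ≤ ε := by
  have hp := hf.hasFPowerSeriesOnBall (zero_lt_one.trans hR)
  set p := cauchyPowerSeries f 0 R
  obtain ⟨r, hr1, hrR⟩ := exists_between hR
  have hu := hp.tendstoUniformlyOn (ENNReal.coe_lt_coe.2 hrR)
  rw [Metric.tendstoUniformlyOn_iff] at hu
  obtain ⟨n, hn, hn1⟩ := ((hu ε hε).and (eventually_ge_atTop 1)).exists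
  refine ⟨∑ k ∈ Finset.range n, C (p.coeff k) * X ^ k, ?_, fun z hz => ?_⟩
  · have h0 : p.coeff 0 = f 0 := by
      have := hp.coeff_zero (fun _ => (0 : ℂ))
      rw [← this, p.apply_eq_pow_smul_coeff]
      simp
    simp only [finsetSum_coeff, coeff_C_mul_X_pow]
    rw [Finset.sum_ite_eq, if_pos (Finset.mem_range.2 hn1), h0]
  · have hz' : z ∈ Metric.ball (0 : ℂ) (r : ℝ) := by
      simpa using lt_of_le_of_lt hz (by exact_mod_cast hr1)
    have h := hn z hz'
    rw [dist_eq_norm, zero_add] at h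
    refine le_of_eq_of_le ?_ h.le
    congr 2
    simp only [FormalMultilinearSeries.partialSum, p.apply_eq_pow_smul_coeff, eval_finsetSum,
      eval_mul, eval_C, eval_pow, eval_X, smul_eq_mul, mul_comm]

theorem expFun_add (a b t : ℝ) : expFun (a + b) t = expFun a t * expFun b t := by
  simp only [expFun, ← Complex.exp_add]
  push_cast
  ring_nf

theorem expFun_natCast (n : ℕ) (t : ℝ) : expFun n t = expFun 1 t ^ n := by
  simp only [expFun, ← Complex.exp_nat_mul]
  push_cast
  ring_nf

theorem norm_expFun (a t : ℝ) : ‖expFun a t‖ = 1 := by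
  rw [expFun, show 2 * (Real.pi : ℂ) * Complex.I * (a : ℂ) * (t : ℂ)
    = ((2 * Real.pi * a * t : ℝ) : ℂ) * Complex.I by push_cast; ring]
  exact Complex.norm_exp_ofReal_mul_I _

theorem continuous_expFun (a : ℝ) : Continuous (expFun a) := by
  unfold expFun
  fun_prop

theorem expFun_one_add_int (t : ℝ) (k : ℤ) : expFun 1 (t + k) = expFun 1 t := by
  simp only [expFun]
  rw [show 2 * (Real.pi : ℂ) * Complex.I * ((1 : ℝ) : ℂ) * ((t + k : ℝ) : ℂ)
    = 2 * (Real.pi : ℂ) * Complex.I * ((1 : ℝ) : ℂ) * (t : ℂ) + k * (2 * Real.pi * Complex.I) by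
      push_cast; ring]
  exact Complex.exp_periodic.int_mul k _

theorem expFun_one_nat_mul (n : ℕ) (t : ℝ) : expFun 1 (n * t) = expFun 1 t ^ n := by
  rw [← expFun_natCast]
  simp only [expFun]
  push_cast
  ring_nf

theorem expFun_one_ne_one {t : ℝ} (h0 : 0 < t) (h1 : t < 1) : expFun 1 t ≠ 1 := by
  intro h
  rw [expFun, Complex.exp_eq_one_iff] at h
  obtain ⟨n, hn⟩ := h
  have h2 : (t : ℂ) = n := by
    have : (2 * (Real.pi : ℂ) * Complex.I) ≠ 0 := Complex.two_pi_I_ne_zero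
    apply mul_left_cancel₀ this
    rw [mul_comm _ (n : ℂ), ← hn]
    push_cast
    ring
  have h3 : t = n := by exact_mod_cast h2
  rw [h3] at h0 h1
  norm_cast at h0 h1
  omega

/-- On the unit circle minus `1`, the function `z / (1 - z)` has real part `-1 / 2`. -/
theorem re_div_one_sub {z : ℂ} (hz : ‖z‖ = 1) (h1 : z ≠ 1) : (z / (1 - z)).re = -1 / 2 := by
  have hn : z.re * z.re + z.im * z.im = 1 := by
    have := Complex.normSq_eq_norm_sq z
    rw [hz, Complex.normSq_apply] at this
    simpa using this
  have hne : 1 - z ≠ 0 := sub_ne_zero.2 (Ne.symm h1)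
  have h2 : Complex.normSq (1 - z) ≠ 0 := by simpa using hne
  have h3 : Complex.normSq (1 - z) = 2 - 2 * z.re := by
    rw [Complex.normSq_apply]
    simp
    linarith
  rw [Complex.div_re, ← add_div, div_eq_div_iff h2 two_ne_zero, h3]
  simp
  linarith

open Polynomial in
/-- There are polynomials without constant term that are close to `1` on the unit circle outside of a
set of small measure. -/
theorem exists_polynomial_near_one {ε : ℝ} (hε : 0 < ε) {η : ℝ≥0∞} (hη : 0 < η) :
    ∃ q : ℂ[X], q.coeff 0 = 0 ∧
      volume.restrict (Set.Ioc (0 : ℝ) 1) {t : ℝ | ε < ‖1 - q.eval (expFun 1 t)‖} ≤ η := by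
  obtain ⟨A, hA⟩ : ∃ A : ℝ, Real.exp (-A) < ε / 3 := by
    have := (Real.tendsto_exp_neg_atTop_nhds_zero).eventually (gt_mem_nhds (show 0 < ε / 3 by linarith))
    exact this.exists
  let r : ℕ → ℝ := fun n => 1 - 1 / ((n : ℝ) + 2)
  have hr0 : ∀ n, 0 < r n := fun n => by
    have : 1 / ((n : ℝ) + 2) < 1 := by
      rw [div_lt_one (by positivity)]
      have : (0 : ℝ) ≤ n := by positivity
      linarith
    simp only [r]; linarith
  have hr1 : ∀ n, r n < 1 := fun n => by
    have : 0 < 1 / ((n : ℝ) + 2) := by positivity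
    simp only [r]; linarith
  have hrt : Tendsto r atTop (𝓝 1) := by
    have h : Tendsto (fun n : ℕ => 1 / ((n : ℝ) + 2)) atTop (𝓝 0) :=
      tendsto_const_nhds.div_atTop (tendsto_natCast_atTop_atTop.atTop_add tendsto_const_nhds)
    simpa [r] using h.const_sub 1
  let F : ℂ → ℂ := fun w => Complex.exp (2 * A * (w / (1 - w)))
  let G : ℕ → ℝ → ℂ := fun n t => F (r n * expFun 1 t)
  let G' : ℝ → ℂ := fun t => F (expFun 1 t)
  have hne : ∀ n (z : ℂ), ‖z‖ < 1 / r n → 1 - (r n : ℂ) * z ≠ 0 := by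
    intro n z hz h
    have h1 : ‖(r n : ℂ) * z‖ < 1 := by
      rw [norm_mul, Complex.norm_real, Real.norm_of_nonneg (hr0 n).le]
      calc r n * ‖z‖ < r n * (1 / r n) := mul_lt_mul_of_pos_left hz (hr0 n)
        _ = 1 := by field_simp [(hr0 n).ne']
    rw [← sub_eq_zero.1 h] at h1
    simp at h1
  have hone : ∀ n, 1 < 1 / r n := fun n => by rw [lt_div_iff₀ (hr0 n)]; linarith [hr1 n]
  have hcont : ∀ n, Continuous (G n) := by
    intro n
    have := continuous_expFun 1
    apply Complex.continuous_exp.comp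
    refine continuous_const.mul (Continuous.div (by fun_prop) (by fun_prop) fun t => ?_)
    exact hne n _ (by rw [norm_expFun]; exact hone n)
  have hlim : ∀ᵐ t ∂(volume.restrict (Set.Ioc (0 : ℝ) 1)),
      Tendsto (fun n => G n t) atTop (𝓝 (G' t)) := by
    rw [← restrict_Ioo_eq_restrict_Ioc]
    refine (ae_restrict_mem measurableSet_Ioo).mono fun t ht => ?_
    have h1 := expFun_one_ne_one ht.1 ht.2
    have h2 : ContinuousAt F (expFun 1 t) := by
      apply Complex.continuous_exp.continuousAt.comp
      exact continuousAt_const.mul (continuousAt_id.div (by fun_prop) (sub_ne_zero.2 h1.symm))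
    refine h2.tendsto.comp ?_
    have : Tendsto (fun n => (r n : ℂ)) atTop (𝓝 ((1 : ℝ) : ℂ)) :=
      (Complex.continuous_ofReal.tendsto 1).comp hrt
    simpa using this.mul_const (expFun 1 t)
  have hmeas := tendstoInMeasure_of_tendsto_ae (fun n => (hcont n).aestronglyMeasurable) hlim
  rw [tendstoInMeasure_iff_norm] at hmeas
  obtain ⟨n, hn⟩ := ((hmeas (ε / 3) (by linarith)).eventually (gt_mem_nhds hη)).exists
  obtain ⟨R, hR1, hR⟩ := exists_between (hone n)
  have hdiff : DifferentiableOn ℂ (fun z => F (r n * z)) (Metric.closedBall 0 (⟨R, by linarith⟩ : NNReal)) := by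
    intro z hz
    apply DifferentiableAt.differentiableWithinAt
    apply DifferentiableAt.cexp
    have := hne n z (lt_of_le_of_lt (by simpa using hz) hR)
    have h1 : DifferentiableAt ℂ (fun z : ℂ => (r n : ℂ) * z) z := by fun_prop
    exact (h1.div (h1.const_sub 1) this).const_mul _
  obtain ⟨P, hP0, hP⟩ := exists_polynomial_approx_of_differentiableOn (by exact hR1) hdiff
    (show 0 < ε / 3 by linarith)
  refine ⟨1 - P, by simp [hP0, F], ?_⟩
  refine le_trans (measure_mono_ae ?_) hn.le
  rw [← restrict_Ioo_eq_restrict_Ioc]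
  refine (ae_restrict_mem measurableSet_Ioo).mono fun t ht (htε : ε < _) => ?_
  change ε / 3 ≤ ‖G n t - G' t‖
  have h1 := hP (expFun 1 t) (norm_expFun 1 t).le
  have h2 : ‖G' t‖ ≤ ε / 3 := by
    refine le_trans (le_of_eq ?_) hA.le
    simp only [G', F]
    rw [Complex.norm_exp]
    congr 1
    have := re_div_one_sub (norm_expFun 1 t) (expFun_one_ne_one ht.1 ht.2)
    rw [show (2 * (A : ℂ)) = ((2 * A : ℝ) : ℂ) by push_cast; ring, Complex.re_ofReal_mul, this]
    ring
  simp only [eval_sub, eval_one, sub_sub_cancel] at htε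
  have h3 : ‖P.eval (expFun 1 t)‖ ≤ ‖G n t - P.eval (expFun 1 t)‖ + ‖G n t - G' t‖ + ‖G' t‖ := by
    calc ‖P.eval (expFun 1 t)‖
        = ‖-(G n t - P.eval (expFun 1 t)) + (G n t - G' t) + G' t‖ := by congr 1; ring
      _ ≤ _ := (norm_add₃_le).trans (by rw [norm_neg])
  have h4 : ‖G n t - P.eval (expFun 1 t)‖ ≤ ε / 3 := h1
  linarith

/-- Lebesgue measure on the period `(0, 1]`. -/
noncomputable abbrev periodMeasure : Measure ℝ := volume.restrict (Set.Ioc 0 1)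

theorem fourier_coe_eq_expFun (k : ℤ) (t : ℝ) : fourier k (t : UnitAddCircle) = expFun k t := by
  rw [fourier_coe_apply, expFun]
  congr 1
  push_cast
  ring

theorem volume_unitAddCircle : (volume : Measure UnitAddCircle) = AddCircle.haarAddCircle := by
  rw [AddCircle.volume_eq_smul_haarAddCircle]
  simp

theorem measurePreserving_coe_unitAddCircle :
    MeasurePreserving (fun t : ℝ => (t : UnitAddCircle)) periodMeasure AddCircle.haarAddCircle := by
  have h := UnitAddCircle.measurePreserving_mk 0
  rw [zero_add, volume_unitAddCircle] at h
  exact h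

theorem eLpNorm_coe_unitAddCircle (F : Lp ℂ 2 (@AddCircle.haarAddCircle 1 _)) :
    eLpNorm (fun t : ℝ => F (t : UnitAddCircle)) 2 periodMeasure = ‖F‖ₑ := by
  rw [Lp.enorm_def]
  exact eLpNorm_comp_measurePreserving (Lp.aestronglyMeasurable F) measurePreserving_coe_unitAddCircle

theorem coeFn_sum_fourierLp (s : Finset ℤ) (c : ℤ → ℂ) :
    (fun t : ℝ => (∑ k ∈ s, c k • fourierLp (T := 1) 2 k : Lp ℂ 2 _) (t : UnitAddCircle))
      =ᵐ[periodMeasure] fun t => ∑ k ∈ s, c k * expFun k t := by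
  refine measurePreserving_coe_unitAddCircle.quasiMeasurePreserving.ae_eq_comp
    (g' := fun x => ∑ k ∈ s, c k * fourier k x) ?_ |>.trans (Eventually.of_forall fun t => ?_)
  · refine (Lp.coeFn_finsetSum s _).trans ?_
    have h : ∀ᵐ x ∂(@AddCircle.haarAddCircle 1 _), ∀ k ∈ s,
        (c k • fourierLp (T := 1) 2 k : Lp ℂ 2 _) x = c k * fourier k x := by
      refine (ae_ball_iff (S := (s : Set ℤ)) s.countable_toSet).2 fun k _ => ?_
      filter_upwards [Lp.coeFn_smul (c k) (fourierLp (T := 1) 2 k), coeFn_fourierLp (T := 1) 2 k]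
        with x h1 h2
      rw [h1, Pi.smul_apply, h2, smul_eq_mul]
    filter_upwards [h] with x hx
    simp only [Finset.sum_apply]
    exact Finset.sum_congr rfl hx
  · simp only [Function.comp_apply, fourier_coe_eq_expFun]

/-- Parseval's identity for trigonometric polynomials with non-negative frequencies. -/
theorem eLpNorm_sum_pow_expFun (s : Finset ℕ) (a : ℕ → ℂ) :
    eLpNorm (fun t => ∑ j ∈ s, a j * expFun 1 t ^ j) 2 periodMeasure
      = ENNReal.ofReal (Real.sqrt (∑ j ∈ s, ‖a j‖ ^ 2)) := by
  have h1 : (fun t => ∑ j ∈ s, a j * expFun 1 t ^ j)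
      = fun t => ∑ k ∈ s.map Nat.castEmbedding, a k.toNat * expFun (k : ℤ) t := by
    ext t
    rw [Finset.sum_map]
    refine Finset.sum_congr rfl fun j _ => ?_
    simp [← expFun_natCast]
  rw [h1, ← eLpNorm_congr_ae (coeFn_sum_fourierLp _ fun k => a k.toNat), eLpNorm_coe_unitAddCircle,
    ← ofReal_norm]
  congr 1
  rw [eq_comm, Real.sqrt_eq_iff_eq_sq (by positivity) (norm_nonneg _)]
  have := orthonormal_fourier (T := 1).inner_sum (fun k => a k.toNat) (fun k => a k.toNat)
    (s.map Nat.castEmbedding)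
  rw [inner_self_eq_norm_sq_to_K, Finset.sum_map s Nat.castEmbedding (fun k : ℤ => conj (a k.toNat) * a k.toNat)] at this
  have h2 : ∀ j ∈ s, conj (a (Nat.castEmbedding (R := ℤ) j).toNat) * a (Nat.castEmbedding (R := ℤ) j).toNat
      = ((‖a j‖ ^ 2 : ℝ) : ℂ) := by
    intro j _
    simp [mul_comm, Complex.mul_conj, Complex.normSq_eq_norm_sq]
  rw [Finset.sum_congr rfl h2, ← Complex.ofReal_sum] at this
  exact Complex.ofReal_injective (by rw [Complex.ofReal_pow]; exact this.symm)

section circle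

open Polynomial

/-- The sum of the terms of degree less than `m`. -/
noncomputable def lowPart (m : ℕ) : ℂ[X] →ₗ[ℂ] ℂ[X] where
  toFun P := ∑ j ∈ Finset.range m, monomial j (P.coeff j)
  map_add' P Q := by simp [Finset.sum_add_distrib]
  map_smul' c P := by simp [Finset.smul_sum, smul_monomial]

theorem lowPart_apply (m : ℕ) (P : ℂ[X]) :
    lowPart m P = ∑ j ∈ Finset.range m, monomial j (P.coeff j) := rfl

theorem eval_lowPart (m : ℕ) (P : ℂ[X]) (z : ℂ) :
    (lowPart m P).eval z = ∑ j ∈ Finset.range m, P.coeff j * z ^ j := by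
  simp [lowPart_apply, eval_finsetSum]

theorem lowPart_eq_self {m : ℕ} {P : ℂ[X]} (h : P.natDegree < m) : lowPart m P = P :=
  (P.as_sum_range' m h).symm

theorem lowPart_eq_zero {m n : ℕ} {P : ℂ[X]} (h : X ^ n ∣ P) (hm : m ≤ n) : lowPart m P = 0 := by
  rw [lowPart_apply]
  refine Finset.sum_eq_zero fun j hj => ?_
  rw [X_pow_dvd_iff.1 h j ((Finset.mem_range.1 hj).trans_le hm), monomial_zero_right]

theorem continuous_eval_expFun (P : ℂ[X]) : Continuous fun t => P.eval (expFun 1 t) :=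
  P.continuous.comp (continuous_expFun 1)

theorem eLpNorm_lowPart_le (m : ℕ) (P : ℂ[X]) :
    eLpNorm (fun t => (lowPart m P).eval (expFun 1 t)) 2 periodMeasure
      ≤ eLpNorm (fun t => P.eval (expFun 1 t)) 2 periodMeasure := by
  have h : (fun t => P.eval (expFun 1 t))
      = fun t => ∑ j ∈ Finset.range (m + P.natDegree + 1), P.coeff j * expFun 1 t ^ j := by
    ext t
    exact eval_eq_sum_range' (by omega) _
  simp_rw [h, eval_lowPart, eLpNorm_sum_pow_expFun]
  gcongr
  omega

theorem eLpNorm_lowPart_mul_X_pow_le (m s : ℕ) (P : ℂ[X]) :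
    eLpNorm (fun t => (lowPart m (P * X ^ s)).eval (expFun 1 t)) 2 periodMeasure
      ≤ eLpNorm (fun t => P.eval (expFun 1 t)) 2 periodMeasure := by
  refine (eLpNorm_lowPart_le _ _).trans (eLpNorm_mono fun t => ?_)
  simp [norm_expFun]

/-- Trigonometric polynomials are dense in `L²(0, 1)`. -/
theorem exists_trig_poly_approx {φ : ℝ → ℂ} (hφ : Measurable φ) (hφ2 : MemLp φ 2 periodMeasure)
    {κ : ℝ≥0∞} (hκ : 0 < κ) :
    ∃ (A : ℕ) (p : ℂ[X]),
      eLpNorm (fun t => expFun (-A) t * p.eval (expFun 1 t) - φ t) 2 periodMeasure ≤ κ := by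
  let F : UnitAddCircle → ℂ := fun x => φ (AddCircle.measurableEquivIoc 1 0 x : ℝ)
  have hF : Measurable F :=
    hφ.comp (measurable_subtype_coe.comp (AddCircle.measurableEquivIoc 1 0).measurable)
  have hFφ : (fun t : ℝ => F (t : UnitAddCircle)) =ᵐ[periodMeasure] φ := by
    refine (ae_restrict_mem measurableSet_Ioc).mono fun t ht => ?_
    change φ (AddCircle.equivIoc 1 0 (t : UnitAddCircle) : ℝ) = φ t
    rw [AddCircle.equivIoc_coe_of_mem]
    simpa using ht
  have hF2 : MemLp F 2 (@AddCircle.haarAddCircle 1 _) := by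
    refine ⟨hF.aestronglyMeasurable, ?_⟩
    rw [← eLpNorm_comp_measurePreserving hF.aestronglyMeasurable measurePreserving_coe_unitAddCircle]
    exact (eLpNorm_congr_ae hFφ).trans_lt hφ2.2
  have hmem : hF2.toLp F ∈ (Submodule.span ℂ (Set.range (fourierLp (T := 1) 2))).topologicalClosure := by
    rw [span_fourierLp_closure_eq_top (by simp)]
    trivial
  obtain ⟨G, hG, hGκ⟩ := EMetric.mem_closure_iff.1 hmem κ hκ
  obtain ⟨c, rfl⟩ := Finsupp.mem_span_range_iff_exists_finsupp.1 hG
  let A := c.support.sup Int.natAbs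
  refine ⟨A, ∑ k ∈ c.support, C (c k) * X ^ (k + A).toNat, le_trans (le_of_eq ?_) hGκ.le⟩
  rw [edist_comm, edist_eq_enorm_sub, ← eLpNorm_coe_unitAddCircle]
  apply eLpNorm_congr_ae
  have h1 : (fun t : ℝ => (hF2.toLp F) (t : UnitAddCircle)) =ᵐ[periodMeasure]
      fun t : ℝ => F (t : UnitAddCircle) :=
    measurePreserving_coe_unitAddCircle.quasiMeasurePreserving.ae_eq_comp hF2.coeFn_toLp
  have h2 := measurePreserving_coe_unitAddCircle.quasiMeasurePreserving.ae_eq_comp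
    (Lp.coeFn_sub (c.sum fun i a => a • fourierLp (T := 1) 2 i) (hF2.toLp F))
  filter_upwards [hFφ, h1, h2, coeFn_sum_fourierLp c.support c] with t h0 h1 h2 h3
  simp only [Function.comp_apply] at h2
  rw [h2, Pi.sub_apply, h1, h0]
  congr 1
  rw [Finsupp.sum, h3, eval_finsetSum, Finset.mul_sum]
  refine Finset.sum_congr rfl fun k hk => ?_
  have hkA : k.natAbs ≤ A := Finset.le_sup (f := Int.natAbs) hk
  rw [eval_mul, eval_C, eval_pow, eval_X, ← expFun_natCast, mul_left_comm, ← expFun_add]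
  congr 2
  have : ((k + A).toNat : ℤ) = k + A := Int.toNat_of_nonneg (by omega)
  have : (((k + A).toNat : ℕ) : ℝ) = k + A := by exact_mod_cast this
  rw [this]
  ring

theorem volume_Ioc_inter_le {b : Set ℝ} (hb : ∀ (t : ℝ) (k : ℤ), t + k ∈ b ↔ t ∈ b) (k l : ℕ) :
    volume (Set.Ioc (k : ℝ) (k + l) ∩ b) ≤ l * volume (Set.Ioc (0 : ℝ) 1 ∩ b) := by
  induction l with
  | zero => simp
  | succ l ih =>
    have h1 : Set.Ioc (k : ℝ) (k + (l + 1 : ℕ)) ∩ b ⊆ (Set.Ioc (k : ℝ) (k + l) ∩ b) ∪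
        (fun t => t + (((-(k + l) : ℤ)) : ℝ)) ⁻¹' (Set.Ioc (0 : ℝ) 1 ∩ b) := by
      rintro t ⟨⟨h1, h2⟩, h3⟩
      by_cases h : t ≤ k + l
      · exact Or.inl ⟨⟨h1, h⟩, h3⟩
      · refine Or.inr ⟨⟨?_, ?_⟩, (hb t _).2 h3⟩ <;> push_cast at * <;> linarith
    refine (measure_mono h1).trans ((measure_union_le _ _).trans ?_)
    rw [measure_preimage_add_right, Nat.cast_succ, add_mul, one_mul]
    gcongr

/-- Equidistribution of a dilated periodic set in the arcs of length `1 / J`. -/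
theorem volume_arc_inter_dilation_le {b : Set ℝ} (hb : ∀ (t : ℝ) (k : ℤ), t + k ∈ b ↔ t ∈ b)
    {J m : ℕ} (hJ : 0 < J) (hm : 0 < m) (i : ℕ) :
    volume (Set.Ioc ((i : ℝ) / J) ((i + 1) / J) ∩ {t | ((m * J : ℕ) : ℝ) * t ∈ b})
      ≤ volume (Set.Ioc (0 : ℝ) 1 ∩ b) / J := by
  have hJ' : (0 : ℝ) < J := by exact_mod_cast hJ
  have hm' : (0 : ℝ) < m := by exact_mod_cast hm
  have h1 : Set.Ioc ((i : ℝ) / J) ((i + 1) / J) ∩ {t | ((m * J : ℕ) : ℝ) * t ∈ b}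
      = (fun t => ((m * J : ℕ) : ℝ) * t) ⁻¹' (Set.Ioc ((m * i : ℕ) : ℝ) ((m * i : ℕ) + m) ∩ b) := by
    ext t
    simp only [Set.mem_inter_iff, Set.mem_Ioc, Set.mem_ofPred_eq, Set.mem_preimage]
    refine and_congr_left fun _ => and_congr ?_ ?_
    · rw [div_lt_iff₀ hJ']
      push_cast
      rw [mul_assoc, mul_lt_mul_iff_right₀ hm', mul_comm]
    · rw [le_div_iff₀ hJ']
      push_cast
      rw [← mul_add_one, mul_assoc, mul_le_mul_iff_right₀ hm', mul_comm]
  rw [h1, Real.volume_preimage_mul_left (by positivity)]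
  have h2 : ENNReal.ofReal |(((m * J : ℕ) : ℝ))⁻¹| = (m : ℝ≥0∞)⁻¹ * (J : ℝ≥0∞)⁻¹ := by
    rw [abs_of_pos (by positivity), ENNReal.ofReal_inv_of_pos (by positivity), ENNReal.ofReal_natCast,
      Nat.cast_mul, ENNReal.mul_inv (by simp) (by simp)]
  rw [h2]
  calc (m : ℝ≥0∞)⁻¹ * (J : ℝ≥0∞)⁻¹ * volume (Set.Ioc ((m * i : ℕ) : ℝ) ((m * i : ℕ) + m) ∩ b)
      ≤ (m : ℝ≥0∞)⁻¹ * (J : ℝ≥0∞)⁻¹ * (m * volume (Set.Ioc (0 : ℝ) 1 ∩ b)) := by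
        gcongr
        exact volume_Ioc_inter_le hb _ _
    _ = ((m : ℝ≥0∞)⁻¹ * m) * (volume (Set.Ioc (0 : ℝ) 1 ∩ b) / J) := by
        rw [div_eq_mul_inv]; ring
    _ = _ := by
        rw [ENNReal.inv_mul_cancel (by exact_mod_cast hm.ne') (by simp), one_mul]

/-- The indicator function of the arc `(i / J, (i + 1) / J]`. -/
noncomputable def arcIndicator (J i : ℕ) : ℝ → ℂ :=
  (Set.Ioc ((i : ℝ) / J) ((i + 1) / J)).indicator fun _ => 1

/-- The sum of the absolute values of the coefficients. -/
noncomputable def coeffSum (q : ℂ[X]) : ℝ≥0∞ := ∑ k ∈ Finset.range (q.natDegree + 1), ‖q.coeff k‖ₑ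

theorem coeffSum_ne_top (q : ℂ[X]) : coeffSum q ≠ ∞ := by
  simp [coeffSum]

theorem enorm_eval_le_coeffSum (q : ℂ[X]) {z : ℂ} (hz : ‖z‖ = 1) : ‖q.eval z‖ₑ ≤ coeffSum q := by
  rw [eval_eq_sum_range]
  refine (enorm_sum_le _ _).trans (Finset.sum_le_sum fun k _ => ?_)
  simp [← ofReal_norm, hz]

theorem measurable_arcIndicator (J i : ℕ) : Measurable (arcIndicator J i) :=
  measurable_const.indicator measurableSet_Ioc

theorem eLpNorm_arcIndicator_le {J : ℕ} (hJ : 0 < J) (i : ℕ) :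
    eLpNorm (arcIndicator J i) 2 periodMeasure ≤ ((J : ℝ≥0∞)⁻¹) ^ (1 / 2 : ℝ) := by
  rw [arcIndicator, eLpNorm_indicator_const measurableSet_Ioc (by simp) (by simp)]
  simp only [enorm_one, one_mul, ENNReal.toReal_ofNat]
  gcongr
  refine (Measure.restrict_apply_le _ _).trans (le_of_eq ?_)
  rw [Real.volume_Ioc, ← sub_div, add_sub_cancel_left, one_div,
    ENNReal.ofReal_inv_of_pos (by exact_mod_cast hJ), ENNReal.ofReal_natCast]

/-- Approximation of the indicator of a short arc, outside of a set of small measure, by a polynomial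
divisible by a high power of `X` whose truncations are small in `L²`. -/
theorem exists_polynomial_near_arcIndicator {q : ℂ[X]} (hq : q.coeff 0 = 0) (ε : ℝ)
    {J : ℕ} (hJ : 0 < J) (i : ℕ) {κ : ℝ≥0∞} (hκ : 0 < κ) (n : ℕ) :
    ∃ (y : ℂ[X]) (r : ℝ → ℂ) (E : Set ℝ), X ^ n ∣ y ∧ Measurable r ∧ MeasurableSet E ∧
      periodMeasure E ≤ periodMeasure {t | ε < ‖1 - q.eval (expFun 1 t)‖} / J ∧
      eLpNorm r 2 periodMeasure ≤ κ ∧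
      (∀ t ∉ E, ‖y.eval (expFun 1 t) - arcIndicator J i t - r t‖ ≤ ε * ‖arcIndicator J i t‖) ∧
      ∀ m, eLpNorm (fun t => (lowPart m y).eval (expFun 1 t)) 2 periodMeasure
        ≤ coeffSum q * ((J : ℝ≥0∞)⁻¹) ^ (1 / 2 : ℝ) + κ := by
  set D := coeffSum q
  have hD : D ≠ ∞ := coeffSum_ne_top q
  have hφ := eLpNorm_arcIndicator_le hJ i
  have hφ2 : MemLp (arcIndicator J i) 2 periodMeasure := by
    refine ⟨(measurable_arcIndicator J i).aestronglyMeasurable, hφ.trans_lt ?_⟩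
    apply ENNReal.rpow_lt_top_of_nonneg (by norm_num)
    simpa using hJ.ne'
  have hκD : D * (κ / (D + 1)) ≤ κ := by
    rw [← mul_div_assoc]
    refine ENNReal.div_le_of_le_mul ?_
    rw [mul_comm]
    gcongr
    exact le_self_add
  obtain ⟨A, p, hp⟩ := exists_trig_poly_approx (measurable_arcIndicator J i) hφ2
    (κ := κ / (D + 1)) (ENNReal.div_pos hκ.ne' (by simp [hD]))
  set ν := (A + n + 1) * J with hν
  have hνA : A + n ≤ ν := by nlinarith
  let b : Set ℝ := {t | ε < ‖1 - q.eval (expFun 1 t)‖}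
  have hb : ∀ (t : ℝ) (k : ℤ), t + k ∈ b ↔ t ∈ b := fun t k => by simp [b, expFun_one_add_int]
  have hbm : MeasurableSet b :=
    measurableSet_lt measurable_const
      (continuous_const.sub (continuous_eval_expFun q)).norm.measurable
  let arc := Set.Ioc ((i : ℝ) / J) ((i + 1) / J)
  let y : ℂ[X] := ∑ k ∈ Finset.range (q.natDegree + 1), q.coeff k • (p * X ^ (k * ν - A))
  have hy : ∀ t, y.eval (expFun 1 t)
      = expFun (-A) t * p.eval (expFun 1 t) * q.eval (expFun 1 (ν * t)) := by
    intro t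
    rw [eval_finsetSum, eval_eq_sum_range (p := q), Finset.mul_sum]
    refine Finset.sum_congr rfl fun k _ => ?_
    rcases Nat.eq_zero_or_pos k with rfl | hk
    · simp [hq]
    have h1 : A ≤ k * ν := by nlinarith
    rw [eval_smul, eval_mul, eval_pow, eval_X, expFun_one_nat_mul, ← pow_mul, ← expFun_natCast,
      ← expFun_natCast, Nat.cast_sub h1, sub_eq_neg_add, expFun_add, smul_eq_mul, mul_comm ν k]
    ring
  refine ⟨y, fun t => (expFun (-A) t * p.eval (expFun 1 t) - arcIndicator J i t) *
    q.eval (expFun 1 (ν * t)), arc ∩ {t | (ν : ℝ) * t ∈ b}, ?_, ?_, ?_, ?_, ?_, ?_, ?_⟩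
  · refine Finset.dvd_sum fun k _ => ?_
    rcases Nat.eq_zero_or_pos k with rfl | hk
    · simp [hq]
    have h1 : n ≤ k * ν - A := by
      have : ν ≤ k * ν := Nat.le_mul_of_pos_left _ hk
      omega
    rw [smul_eq_C_mul]
    exact ((pow_dvd_pow X h1).trans (dvd_mul_left _ p)).mul_left _
  · exact (((continuous_expFun _).measurable.mul (continuous_eval_expFun p).measurable).sub
      (measurable_arcIndicator J i)).mul
      ((continuous_eval_expFun q).measurable.comp (measurable_const_mul _))
  · exact measurableSet_Ioc.inter (hbm.preimage (measurable_const_mul _))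
  · refine (Measure.restrict_apply_le _ _).trans ?_
    rw [Measure.restrict_apply hbm, Set.inter_comm b]
    exact volume_arc_inter_dilation_le hb hJ (by omega) i
  · refine le_trans ?_ hκD
    refine (eLpNorm_le_mul_eLpNorm_of_ae_le_mul (c := D.toReal)
      (g := fun t => expFun (-A) t * p.eval (expFun 1 t) - arcIndicator J i t)
      (Eventually.of_forall fun t => ?_) 2).trans ?_
    · rw [norm_mul, mul_comm]
      gcongr
      have := ENNReal.toReal_mono hD (enorm_eval_le_coeffSum q (norm_expFun 1 (ν * t)))
      simpa using this
    · rw [ENNReal.ofReal_toReal hD]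
      gcongr
  · intro t ht
    rw [hy, show expFun (-A) t * p.eval (expFun 1 t) * q.eval (expFun 1 (ν * t)) - arcIndicator J i t
      - (expFun (-A) t * p.eval (expFun 1 t) - arcIndicator J i t) * q.eval (expFun 1 (ν * t))
      = -(1 - q.eval (expFun 1 (ν * t))) * arcIndicator J i t by ring, norm_mul, norm_neg]
    by_cases h : t ∈ arc
    · gcongr
      by_contra! h'
      exact ht ⟨h, h'⟩
    · have : arcIndicator J i t = 0 := Set.indicator_of_notMem h _
      simp [this]
  · intro m
    have hlow : (fun t => (lowPart m y).eval (expFun 1 t)) = ∑ k ∈ Finset.range (q.natDegree + 1),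
        q.coeff k • fun t => (lowPart m (p * X ^ (k * ν - A))).eval (expFun 1 t) := by
      ext t
      simp [y, eval_finsetSum, eval_smul]
    have hpn : eLpNorm (fun t => p.eval (expFun 1 t)) 2 periodMeasure
        ≤ κ / (D + 1) + ((J : ℝ≥0∞)⁻¹) ^ (1 / 2 : ℝ) := by
      calc eLpNorm (fun t => p.eval (expFun 1 t)) 2 periodMeasure
          = eLpNorm (fun t => expFun (-A) t * p.eval (expFun 1 t)) 2 periodMeasure :=
            eLpNorm_congr_norm_ae (Eventually.of_forall fun t => by simp [norm_expFun])
        _ = eLpNorm ((fun t => expFun (-A) t * p.eval (expFun 1 t) - arcIndicator J i t)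
            + arcIndicator J i) 2 periodMeasure := by
            congr 1; ext t; simp
        _ ≤ _ := (eLpNorm_add_le ((((continuous_expFun _).measurable.mul
            (continuous_eval_expFun p).measurable).sub
              (measurable_arcIndicator J i)).aestronglyMeasurable)
              (measurable_arcIndicator J i).aestronglyMeasurable (by simp)).trans
              (add_le_add hp hφ)
    rw [hlow]
    calc _ ≤ ∑ k ∈ Finset.range (q.natDegree + 1),
          eLpNorm (q.coeff k • fun t => (lowPart m (p * X ^ (k * ν - A))).eval (expFun 1 t)) 2
            periodMeasure :=
          eLpNorm_sum_le (fun k _ => ((continuous_eval_expFun _).const_smul _).aestronglyMeasurable)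
            (by simp)
      _ ≤ ∑ k ∈ Finset.range (q.natDegree + 1), ‖q.coeff k‖ₑ *
          (κ / (D + 1) + ((J : ℝ≥0∞)⁻¹) ^ (1 / 2 : ℝ)) := by
          gcongr with k _
          rw [eLpNorm_const_smul]
          gcongr
          exact (eLpNorm_lowPart_mul_X_pow_le _ _ _).trans hpn
      _ = D * (κ / (D + 1)) + D * ((J : ℝ≥0∞)⁻¹) ^ (1 / 2 : ℝ) := by
          rw [← Finset.sum_mul, mul_add]; rfl
      _ ≤ _ := by
          rw [add_comm]
          gcongr

/-- The indicator function of the initial arc `(0, i / J]`. -/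
noncomputable def initialIndicator (J i : ℕ) : ℝ → ℂ :=
  (Set.Ioc (0 : ℝ) (i / J)).indicator fun _ => 1

theorem norm_initialIndicator_le (J i : ℕ) (t : ℝ) : ‖initialIndicator J i t‖ ≤ 1 :=
  (norm_indicator_le_norm_self _ t).trans (by simp)

theorem initialIndicator_succ {J : ℕ} (hJ : 0 < J) (i : ℕ) (t : ℝ) :
    initialIndicator J (i + 1) t = initialIndicator J i t + arcIndicator J i t ∧
    ‖initialIndicator J (i + 1) t‖ = ‖initialIndicator J i t‖ + ‖arcIndicator J i t‖ := by
  have hJ' : (0 : ℝ) < J := by exact_mod_cast hJ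
  have h0 : (0 : ℝ) ≤ i / J := by positivity
  have h1 : (i : ℝ) / J ≤ (i + 1) / J := by gcongr; linarith
  simp only [initialIndicator, arcIndicator, Set.indicator, Set.mem_Ioc, Nat.cast_add, Nat.cast_one]
  rcases le_or_gt t 0 with ht | ht
  · simp [ht.not_gt, (ht.trans h0).not_gt]
  rcases le_or_gt t (i / J) with hti | hti
  · simp [ht, hti, hti.trans h1]
  rcases le_or_gt t ((i + 1) / J) with htj | htj
  · simp [ht, hti, htj]
  · simp [ht, hti.not_ge, htj.not_ge]

theorem eLpNorm_le_of_norm_sub_sub_le {μ : Measure ℝ} (hμ : μ Set.univ ≤ 1) {f g r : ℝ → ℂ}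
    (hr : Measurable r) {ε : ℝ} (hε : 0 ≤ ε) (hg : ∀ t, ‖g t‖ ≤ 1) {E : Set ℝ} (hE : MeasurableSet E)
    (h : ∀ t ∉ E, ‖f t - g t - r t‖ ≤ ε * ‖g t‖) :
    eLpNorm f 2 (μ.restrict Eᶜ) ≤ 1 + ENNReal.ofReal ε + eLpNorm r 2 μ := by
  have h1 : ∀ᵐ t ∂(μ.restrict Eᶜ), ‖f t‖ ≤ ‖(1 + ε) + ‖r t‖‖ := by
    filter_upwards [ae_restrict_mem hE.compl] with t ht
    rw [Real.norm_of_nonneg (by positivity)]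
    calc ‖f t‖ = ‖(f t - g t - r t) + g t + r t‖ := by congr 1; ring
      _ ≤ ε * ‖g t‖ + ‖g t‖ + ‖r t‖ := (norm_add₃_le).trans (by gcongr; exact h t ht)
      _ ≤ ε * 1 + 1 + ‖r t‖ := by gcongr <;> exact hg t
      _ = _ := by ring
  have hm : AEStronglyMeasurable (fun t => ‖r t‖) μ := hr.norm.aestronglyMeasurable
  calc eLpNorm f 2 (μ.restrict Eᶜ) ≤ eLpNorm (fun t => (1 + ε) + ‖r t‖) 2 (μ.restrict Eᶜ) :=
        eLpNorm_mono_ae h1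
    _ ≤ eLpNorm (fun t => (1 + ε) + ‖r t‖) 2 μ := eLpNorm_mono_measure _ Measure.restrict_le_self
    _ ≤ eLpNorm (fun _ => (1 + ε)) 2 μ + eLpNorm (fun t => ‖r t‖) 2 μ :=
        eLpNorm_add_le aestronglyMeasurable_const hm (by simp)
    _ ≤ 1 + ENNReal.ofReal ε + eLpNorm r 2 μ := by
        rw [eLpNorm_norm]
        gcongr
        refine (eLpNorm_le_of_ae_bound (C := 1 + ε) (Eventually.of_forall fun t => ?_)).trans ?_
        · rw [Real.norm_of_nonneg (by positivity)]
        · rw [← ENNReal.ofReal_one, ← ENNReal.ofReal_add zero_le_one hε]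
          exact mul_le_of_le_one_left' (ENNReal.rpow_le_one hμ (by positivity))

theorem periodMeasure_univ : periodMeasure Set.univ = 1 := by simp

theorem exists_polynomial_near_initialIndicator {q : ℂ[X]} (hq : q.coeff 0 = 0) {ε : ℝ} (hε : 0 ≤ ε)
    {J : ℕ} (hJ : 0 < J) {κ : ℝ≥0∞} (hκ : 0 < κ) (n i : ℕ) :
    ∃ (Y : ℂ[X]) (r : ℝ → ℂ) (E : Set ℝ), X ^ n ∣ Y ∧ Measurable r ∧ MeasurableSet E ∧
      periodMeasure E ≤ i * (periodMeasure {t | ε < ‖1 - q.eval (expFun 1 t)‖} / J) ∧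
      eLpNorm r 2 periodMeasure ≤ i * κ ∧
      (∀ t ∉ E, ‖Y.eval (expFun 1 t) - initialIndicator J i t - r t‖
        ≤ ε * ‖initialIndicator J i t‖) ∧
      ∀ m, eLpNorm (fun t => (lowPart m Y).eval (expFun 1 t)) 2 (periodMeasure.restrict Eᶜ)
        ≤ 1 + ENNReal.ofReal ε + i * κ + (coeffSum q * ((J : ℝ≥0∞)⁻¹) ^ (1 / 2 : ℝ) + κ) := by
  induction i with
  | zero =>
    exact ⟨0, 0, ∅, dvd_zero _, measurable_zero, MeasurableSet.empty, by simp, by simp,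
      by simp [initialIndicator], by simp⟩
  | succ i ih =>
    obtain ⟨Y, r, E, hY, hr, hE, hEm, hrκ, hbd, hlow⟩ := ih
    obtain ⟨y, s, E', hy, hs, hE', hEm', hsκ, hbd', hlow'⟩ :=
      exists_polynomial_near_arcIndicator hq ε hJ i hκ (n + Y.natDegree + 1)
    refine ⟨Y + y, r + s, E ∪ E', dvd_add hY ((pow_dvd_pow X (by omega)).trans hy), hr.add hs,
      hE.union hE', ?_, ?_, ?_, fun m => ?_⟩
    · rw [Nat.cast_succ, add_mul, one_mul]
      exact (measure_union_le _ _).trans (add_le_add hEm hEm')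
    · rw [Nat.cast_succ, add_mul, one_mul]
      exact (eLpNorm_add_le hr.aestronglyMeasurable hs.aestronglyMeasurable (by simp)).trans
        (add_le_add hrκ hsκ)
    · intro t ht
      rw [Set.mem_union, not_or] at ht
      obtain ⟨h1, h2⟩ := initialIndicator_succ hJ i t
      rw [h2, h1, mul_add, eval_add, Pi.add_apply]
      refine le_trans (le_of_eq_of_le ?_ (norm_add_le _ _)) (add_le_add (hbd t ht.1) (hbd' t ht.2))
      congr 1
      ring
    · have hsub : periodMeasure.restrict (E ∪ E')ᶜ ≤ periodMeasure.restrict Eᶜ :=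
        Measure.restrict_mono (Set.compl_subset_compl.2 Set.subset_union_left) le_rfl
      have hi : (i : ℝ≥0∞) * κ ≤ (i + 1 : ℕ) * κ := by gcongr; omega
      rw [map_add]
      rcases le_or_gt m (Y.natDegree + 1) with hm | hm
      · rw [lowPart_eq_zero hy (by omega), add_zero]
        refine ((eLpNorm_mono_measure _ hsub).trans (hlow m)).trans ?_
        gcongr
      · rw [lowPart_eq_self (P := Y) (by omega)]
        have hYn := eLpNorm_le_of_norm_sub_sub_le periodMeasure_univ.le hr hε
          (norm_initialIndicator_le J i) hE hbd
        simp only [eval_add]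
        refine (eLpNorm_add_le (continuous_eval_expFun _).aestronglyMeasurable
          (continuous_eval_expFun _).aestronglyMeasurable (by simp)).trans (add_le_add ?_ ?_)
        · refine ((eLpNorm_mono_measure _ hsub).trans hYn).trans ?_
          gcongr
          exact hrκ.trans hi
        · exact (eLpNorm_mono_measure _ Measure.restrict_le_self).trans (hlow' m)

/-- Outside of a set of small measure, the constant `1` is close in `L²` to a polynomial divisible by a
given power of `X`, all truncations of which are bounded by an absolute constant. -/
theorem exists_polynomial_near_one_lowPart_le (n : ℕ) {δ : ℝ} (hδ : 0 < δ) (hδ1 : δ ≤ 1) :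
    ∃ (Y : ℂ[X]) (E : Set ℝ), X ^ n ∣ Y ∧ MeasurableSet E ∧ periodMeasure E ≤ ENNReal.ofReal δ ∧
      eLpNorm (fun t => 1 - Y.eval (expFun 1 t)) 2 (periodMeasure.restrict Eᶜ) ≤ ENNReal.ofReal δ ∧
      ∀ m, eLpNorm (fun t => (lowPart m Y).eval (expFun 1 t)) 2 (periodMeasure.restrict Eᶜ) ≤ 5 := by
  have hδ2 : 0 < δ / 2 := by linarith
  obtain ⟨q, hq, hqη⟩ := exists_polynomial_near_one hδ2 (ENNReal.ofReal_pos.2 hδ)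
  have hlim : Tendsto (fun J : ℕ => coeffSum q * ((J : ℝ≥0∞)⁻¹) ^ (1 / 2 : ℝ)) atTop (𝓝 0) := by
    have h1 : Tendsto (fun J : ℕ => ((J : ℝ≥0∞)⁻¹) ^ (1 / 2 : ℝ)) atTop (𝓝 0) := by
      have := (ENNReal.continuous_rpow_const (y := 1 / 2)).tendsto 0 |>.comp
        ENNReal.tendsto_inv_nat_nhds_zero
      simpa [Function.comp_def] using this
    simpa using ENNReal.Tendsto.const_mul h1 (Or.inr (coeffSum_ne_top q))
  obtain ⟨J, hJD, hJ⟩ := ((hlim.eventually (gt_mem_nhds zero_lt_one)).and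
    (eventually_gt_atTop 0)).exists
  have hJ0 : (J : ℝ≥0∞) ≠ 0 := by exact_mod_cast hJ.ne'
  have hJκ : (J : ℝ≥0∞) * (ENNReal.ofReal (δ / 2) / J) = ENNReal.ofReal (δ / 2) :=
    ENNReal.mul_div_cancel hJ0 (by simp)
  obtain ⟨Y, r, E, hY, hr, hE, hEm, hrκ, hbd, hlow⟩ :=
    exists_polynomial_near_initialIndicator hq hδ2.le hJ
      (κ := ENNReal.ofReal (δ / 2) / J) (ENNReal.div_pos (by simpa using hδ2) (by simp)) n J
  rw [hJκ] at hrκ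
  have hhalf : ENNReal.ofReal (δ / 2) ≤ 1 := by
    rw [← ENNReal.ofReal_one]
    exact ENNReal.ofReal_le_ofReal (by linarith)
  refine ⟨Y, E, hY, hE, ?_, ?_, fun m => (hlow m).trans ?_⟩
  · rw [ENNReal.mul_div_cancel hJ0 (by simp)] at hEm
    exact hEm.trans hqη
  · have h1 : ∀ᵐ t ∂(periodMeasure.restrict Eᶜ),
        ‖1 - Y.eval (expFun 1 t)‖ ≤ ‖δ / 2 + ‖r t‖‖ := by
      have hmem : ∀ᵐ t ∂(periodMeasure.restrict Eᶜ), t ∈ Set.Ioc (0 : ℝ) 1 :=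
        ae_restrict_of_ae (ae_restrict_mem measurableSet_Ioc)
      filter_upwards [ae_restrict_mem hE.compl, hmem] with t ht ht1
      have hI : initialIndicator J J t = 1 := by
        refine Set.indicator_of_mem ?_ _
        rwa [div_self (by exact_mod_cast hJ.ne')]
      have h2 := hbd t ht
      rw [hI, norm_one, mul_one] at h2
      rw [Real.norm_of_nonneg (by positivity)]
      calc ‖1 - Y.eval (expFun 1 t)‖ = ‖(Y.eval (expFun 1 t) - 1 - r t) + r t‖ := by
            rw [← norm_neg]; congr 1; ring
        _ ≤ _ := (norm_add_le _ _).trans (by gcongr)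
    calc _ ≤ eLpNorm (fun t => δ / 2 + ‖r t‖) 2 (periodMeasure.restrict Eᶜ) := eLpNorm_mono_ae h1
      _ ≤ eLpNorm (fun t => δ / 2 + ‖r t‖) 2 periodMeasure :=
          eLpNorm_mono_measure _ Measure.restrict_le_self
      _ ≤ eLpNorm (fun _ => δ / 2) 2 periodMeasure + eLpNorm (fun t => ‖r t‖) 2 periodMeasure :=
          eLpNorm_add_le aestronglyMeasurable_const hr.norm.aestronglyMeasurable (by simp)
      _ ≤ ENNReal.ofReal (δ / 2) + ENNReal.ofReal (δ / 2) := by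
          rw [eLpNorm_norm]
          gcongr
          refine (eLpNorm_le_of_ae_bound (C := δ / 2) (Eventually.of_forall fun t => ?_)).trans ?_
          · rw [Real.norm_of_nonneg hδ2.le]
          · simp
      _ = ENNReal.ofReal δ := by rw [← ENNReal.ofReal_add hδ2.le hδ2.le, add_halves]
  · rw [hJκ]
    have hκ1 : ENNReal.ofReal (δ / 2) / J ≤ 1 :=
      (ENNReal.div_le_of_le_mul (hhalf.trans (by rw [one_mul]; exact_mod_cast hJ)))
    calc _ ≤ (1 : ℝ≥0∞) + 1 + 1 + (1 + 1) := by gcongr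
      _ = 5 := by norm_num

theorem lintegral_floor_mul_fract {H : ℝ → ℝ≥0∞} (hH : Measurable H) (c : ℤ → ℝ≥0∞) :
    ∫⁻ t : ℝ, c ⌊t⌋ * H (Int.fract t) = (∑' k, c k) * ∫⁻ t, H t ∂periodMeasure := by
  have h1 : ∀ k : ℤ, ∫⁻ t in Set.Ico (k : ℝ) (k + 1), c ⌊t⌋ * H (Int.fract t)
      = c k * ∫⁻ t, H t ∂periodMeasure := by
    intro k
    calc ∫⁻ t in Set.Ico (k : ℝ) (k + 1), c ⌊t⌋ * H (Int.fract t)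
        = ∫⁻ t, c k * (Set.Ico (0 : ℝ) 1).indicator H (t - k) := by
          rw [← lintegral_indicator measurableSet_Ico]
          congr 1 with t
          by_cases ht : t ∈ Set.Ico (k : ℝ) (k + 1)
          · have hf : ⌊t⌋ = k := Int.floor_eq_iff.2 ht
            have ht' : t - k ∈ Set.Ico (0 : ℝ) 1 :=
              ⟨by linarith [ht.1], by linarith [ht.2]⟩
            rw [Set.indicator_of_mem ht, Set.indicator_of_mem ht', Int.fract, hf]
          · have ht' : t - k ∉ Set.Ico (0 : ℝ) 1 := fun h =>
              ht ⟨by linarith [h.1], by linarith [h.2]⟩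
            rw [Set.indicator_of_notMem ht, Set.indicator_of_notMem ht', mul_zero]
      _ = c k * ∫⁻ t, (Set.Ico (0 : ℝ) 1).indicator H t := by
          have hm : Measurable fun t => (Set.Ico (0 : ℝ) 1).indicator H (t - k) :=
            (hH.indicator measurableSet_Ico).comp (measurable_sub_const _)
          rw [lintegral_const_mul _ hm, lintegral_sub_right_eq_self]
      _ = _ := by
          rw [lintegral_indicator measurableSet_Ico, restrict_Ico_eq_restrict_Ioc]
  rw [← setLIntegral_univ, ← iUnion_Ico_intCast ℝ, lintegral_iUnion (fun _ => measurableSet_Ico)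
    (Set.pairwise_disjoint_Ico_intCast ℝ), tsum_congr h1, ENNReal.tsum_mul_right]

theorem ae_fract_of_ae_periodMeasure {p : ℝ → Prop} (hp : ∀ᵐ t ∂periodMeasure, p t) :
    ∀ᵐ t : ℝ, p (Int.fract t) := by
  obtain ⟨s, hs, hsm, hs0⟩ := exists_measurable_superset_of_null hp
  have h := lintegral_floor_mul_fract (measurable_one.indicator hsm) fun _ => 1
  rw [lintegral_indicator_one hsm, hs0, mul_zero] at h
  have hm : Measurable fun t : ℝ => (1 : ℝ≥0∞) * s.indicator 1 (Int.fract t) :=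
    measurable_const.mul ((measurable_one.indicator hsm).comp measurable_fract)
  rw [lintegral_eq_zero_iff hm] at h
  filter_upwards [h] with t ht
  by_contra hpt
  have : Int.fract t ∈ s := hs hpt
  simp [this] at ht

theorem enorm_eval_lowPart_le_coeffSum (m : ℕ) (q : ℂ[X]) {z : ℂ} (hz : ‖z‖ = 1) :
    ‖(lowPart m q).eval z‖ₑ ≤ coeffSum q := by
  rw [eval_lowPart]
  calc ‖∑ j ∈ Finset.range m, q.coeff j * z ^ j‖ₑ ≤ ∑ j ∈ Finset.range m, ‖q.coeff j‖ₑ :=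
        (enorm_sum_le _ _).trans (Finset.sum_le_sum fun k _ => by simp [← ofReal_norm, hz])
    _ ≤ ∑ j ∈ Finset.range (m + (q.natDegree + 1)), ‖q.coeff j‖ₑ :=
        Finset.sum_le_sum_of_subset (Finset.range_mono (by omega))
    _ = coeffSum q := by
        rw [coeffSum]
        refine (Finset.sum_subset (Finset.range_mono (by omega)) fun j _ hj => ?_).symm
        rw [coeff_eq_zero_of_natDegree_lt (by simpa using hj), enorm_zero]

/-- The factor that equals at most `τ n` on the 1-periodic extension of `E n`. -/
noncomputable def dampingFactor (E : ℕ → Set ℝ) (τ : ℕ → ℝ) (t : ℝ) : ℝ :=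
  ⨅ n, (E n).indicator (fun _ => τ n - 1) (Int.fract t) + 1

section damping

variable {E : ℕ → Set ℝ} {τ : ℕ → ℝ}

theorem dampingFactor_bddBelow (hτ : ∀ n, 0 < τ n) (t : ℝ) :
    BddBelow (Set.range fun n => (E n).indicator (fun _ => τ n - 1) (Int.fract t) + 1) := by
  refine ⟨0, ?_⟩
  rintro _ ⟨n, rfl⟩
  by_cases h : Int.fract t ∈ E n <;> simp [h, (hτ n).le]

theorem dampingFactor_le (hτ : ∀ n, 0 < τ n) {n : ℕ} {t : ℝ} (h : Int.fract t ∈ E n) :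
    dampingFactor E τ t ≤ τ n :=
  (ciInf_le (dampingFactor_bddBelow hτ t) n).trans (by simp [h])

theorem dampingFactor_le_one (hτ : ∀ n, 0 < τ n) (hτ1 : ∀ n, τ n ≤ 1) (t : ℝ) :
    dampingFactor E τ t ≤ 1 := by
  refine (ciInf_le (dampingFactor_bddBelow hτ t) 0).trans ?_
  by_cases h : Int.fract t ∈ E 0 <;> simp [h, hτ1 0]

theorem dampingFactor_pos (hτ : ∀ n, 0 < τ n) {t : ℝ}
    (h : ∀ᶠ n in atTop, Int.fract t ∉ E n) : 0 < dampingFactor E τ t := by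
  obtain ⟨N, hN⟩ := eventually_atTop.1 h
  have h1 : ∀ᶠ c : ℝ in 𝓝[>] 0, ∀ n ∈ Finset.range N, c ≤ τ n :=
    (Finset.eventually_all _).2 fun n _ => mem_nhdsWithin_of_mem_nhds (ge_mem_nhds (hτ n))
  obtain ⟨c, ⟨hcτ, hc1⟩, hc0⟩ := ((h1.and (mem_nhdsWithin_of_mem_nhds
    (ge_mem_nhds (zero_lt_one' ℝ)))).and (eventually_mem_nhdsWithin)).exists
  refine lt_of_lt_of_le hc0 (le_ciInf fun n => ?_)
  by_cases hn : Int.fract t ∈ E n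
  · have hnN : n < N := by
      by_contra! h'
      exact hN n h' hn
    simpa [hn] using hcτ n (Finset.mem_range.2 hnN)
  · simpa [hn] using hc1

theorem measurable_dampingFactor (hE : ∀ n, MeasurableSet (E n)) : Measurable (dampingFactor E τ) :=
  Measurable.iInf fun n =>
    ((measurable_const.indicator (hE n)).comp measurable_fract).add_const 1

theorem dampingFactor_fract (t : ℝ) : dampingFactor E τ (Int.fract t) = dampingFactor E τ t := by
  simp [dampingFactor]

end damping

/-- The measure on the period with density `dampingFactor`. -/
noncomputable def dampedMeasure (E : ℕ → Set ℝ) (τ : ℕ → ℝ) : Measure ℝ :=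
  periodMeasure.withDensity fun t => ENNReal.ofReal (dampingFactor E τ t)

section damping

variable {E : ℕ → Set ℝ} {τ : ℕ → ℝ}

theorem eLpNorm_le_dampedMeasure (hE : ∀ n, MeasurableSet (E n)) {w : ℝ → ℝ} {c : ℤ → ℝ≥0∞}
    (hc : ∑' k, c k ≤ 1)
    (hw : ∀ᵐ t, ENNReal.ofReal (w t) ≤ c ⌊t⌋ * ENNReal.ofReal (dampingFactor E τ t))
    {f : ℝ → ℂ} (hf : Measurable f) (hper : ∀ t, f (Int.fract t) = f t) :
    eLpNorm f 2 (weightMeasure w) ≤ eLpNorm f 2 (dampedMeasure E τ) := by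
  have hg : Measurable fun t => ENNReal.ofReal (dampingFactor E τ t) :=
    (measurable_dampingFactor hE).ennreal_ofReal
  have hcm : Measurable fun t : ℝ => c ⌊t⌋ := (measurable_of_countable c).comp Int.measurable_floor
  have h2 : Measurable fun t => ‖f t‖ₑ ^ (2 : ℝ≥0∞).toReal := hf.enorm.pow_const _
  refine (eLpNorm_mono_measure f (withDensity_mono hw)).trans ?_
  rw [eLpNorm_eq_lintegral_rpow_enorm_toReal (by simp) (by simp),
    eLpNorm_eq_lintegral_rpow_enorm_toReal (by simp) (by simp)]
  refine ENNReal.rpow_le_rpow ?_ (by positivity)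
  have hcg : Measurable fun t : ℝ => c ⌊t⌋ * ENNReal.ofReal (dampingFactor E τ t) := hcm.mul hg
  rw [dampedMeasure, lintegral_withDensity_eq_lintegral_mul _ hcg h2,
    lintegral_withDensity_eq_lintegral_mul _ hg h2]
  calc _ = ∫⁻ t : ℝ, c ⌊t⌋ * (ENNReal.ofReal (dampingFactor E τ (Int.fract t)) *
        ‖f (Int.fract t)‖ₑ ^ (2 : ℝ≥0∞).toReal) := by
        congr 1 with t
        simp only [Pi.mul_apply, dampingFactor_fract, hper, mul_assoc]
    _ = (∑' k, c k) * ∫⁻ t, ENNReal.ofReal (dampingFactor E τ t) *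
        ‖f t‖ₑ ^ (2 : ℝ≥0∞).toReal ∂periodMeasure := lintegral_floor_mul_fract (hg.mul h2) c
    _ ≤ 1 * _ := by gcongr
    _ = _ := by rw [one_mul]; rfl

theorem dampedMeasure_le (hτ : ∀ n, 0 < τ n) (hτ1 : ∀ n, τ n ≤ 1) :
    dampedMeasure E τ ≤ periodMeasure := by
  refine (withDensity_mono (g := 1) (Eventually.of_forall fun t => ?_)).trans_eq withDensity_one
  simpa using dampingFactor_le_one hτ hτ1 t

theorem dampedMeasure_apply_le (hE : ∀ n, MeasurableSet (E n)) (hτ : ∀ n, 0 < τ n) (n : ℕ) :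
    dampedMeasure E τ (E n) ≤ ENNReal.ofReal (τ n) := by
  rw [dampedMeasure, withDensity_apply _ (hE n)]
  have hmem : ∀ᵐ t ∂(periodMeasure.restrict (E n)), t ∈ Set.Ioo (0 : ℝ) 1 := by
    refine ae_restrict_of_ae ?_
    rw [periodMeasure, ← restrict_Ioo_eq_restrict_Ioc]
    exact ae_restrict_mem measurableSet_Ioo
  calc _ ≤ ∫⁻ _ in E n, ENNReal.ofReal (τ n) ∂periodMeasure := by
        refine lintegral_mono_ae ?_
        filter_upwards [hmem, ae_restrict_mem (hE n)] with t ht htE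
        refine ENNReal.ofReal_le_ofReal (dampingFactor_le hτ ?_)
        rwa [Int.fract_eq_self.2 ⟨ht.1.le, ht.2⟩]
    _ ≤ ENNReal.ofReal (τ n) * 1 := by
        rw [setLIntegral_const]
        gcongr
        exact (measure_mono (Set.subset_univ _)).trans periodMeasure_univ.le
    _ = _ := mul_one _

theorem eLpNorm_dampedMeasure_le (hE : ∀ n, MeasurableSet (E n)) (hτ : ∀ n, 0 < τ n)
    (hτ1 : ∀ n, τ n ≤ 1) (n : ℕ) {f : ℝ → ℂ} (hf : Measurable f) {D : ℝ} (hD : ∀ t, ‖f t‖ ≤ D) :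
    eLpNorm f 2 (dampedMeasure E τ) ≤ eLpNorm f 2 (periodMeasure.restrict (E n)ᶜ)
      + ENNReal.ofReal (√(τ n)) * ENNReal.ofReal D := by
  calc eLpNorm f 2 (dampedMeasure E τ)
      = eLpNorm ((E n)ᶜ.indicator f + (E n).indicator f) 2 (dampedMeasure E τ) := by
        rw [Set.indicator_compl_add_self]
    _ ≤ eLpNorm f 2 ((dampedMeasure E τ).restrict (E n)ᶜ)
        + eLpNorm f 2 ((dampedMeasure E τ).restrict (E n)) := by
        rw [← eLpNorm_indicator_eq_eLpNorm_restrict (hE n),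
          ← eLpNorm_indicator_eq_eLpNorm_restrict (hE n).compl]
        exact eLpNorm_add_le (hf.indicator (hE n).compl).aestronglyMeasurable
          (hf.indicator (hE n)).aestronglyMeasurable (by simp)
    _ ≤ _ := by
        refine add_le_add (eLpNorm_mono_measure _
          (Measure.restrict_mono_measure (dampedMeasure_le hτ hτ1) _)) ?_
        refine (eLpNorm_le_of_ae_bound (Eventually.of_forall hD)).trans ?_
        gcongr
        rw [Measure.restrict_apply_univ, Real.sqrt_eq_rpow,
          ← ENNReal.ofReal_rpow_of_nonneg (hτ n).le (by norm_num)]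
        simp only [ENNReal.toReal_ofNat, one_div]
        gcongr
        exact dampedMeasure_apply_le hE hτ n

end damping

/-- Below every weight there is a weight in whose `L²` space the constant `1` is a limit of
trigonometric polynomials with arbitrarily high integer frequencies and bounded partial sums. -/
theorem exists_weight_near_one (w₀ : ℝ → ℝ) (hw₀ : IsWeight w₀) :
    ∃ w : ℝ → ℝ, IsWeight w ∧ (∀ᵐ t : ℝ, w t ≤ w₀ t) ∧ ∀ n : ℕ, ∃ Y : ℂ[X], X ^ n ∣ Y ∧
      eLpNorm (fun t => 1 - Y.eval (expFun 1 t)) 2 (weightMeasure w)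
        ≤ ENNReal.ofReal (2 * (1 / 2) ^ n) ∧
      ∀ m, eLpNorm (fun t => (lowPart m Y).eval (expFun 1 t)) 2 (weightMeasure w) ≤ 6 := by
  have hδ : ∀ n : ℕ, (0 : ℝ) < (1 / 2) ^ n := fun n => by positivity
  have hδ1 : ∀ n : ℕ, ((1 : ℝ) / 2) ^ n ≤ 1 := fun n => pow_le_one₀ (by norm_num) (by norm_num)
  choose Y E hY hE hEm hY1 hlow using fun n => exists_polynomial_near_one_lowPart_le n (hδ n) (hδ1 n)
  let D : ℕ → ℝ := fun n => 1 + (coeffSum (Y n)).toReal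
  have hD1 : ∀ n, 1 ≤ D n := fun n => by simp [D]
  let τ : ℕ → ℝ := fun n => ((1 / 2) ^ n / D n) ^ 2
  have hτ : ∀ n, 0 < τ n := fun n => by
    have := hD1 n
    positivity
  have hτD : ∀ n, √(τ n) * D n = (1 / 2) ^ n := fun n => by
    have := hD1 n
    rw [Real.sqrt_sq (by positivity)]
    field_simp
  have hτ1 : ∀ n, τ n ≤ 1 := fun n => by
    have := hD1 n
    exact pow_le_one₀ (by positivity) ((div_le_one (by positivity)).2 ((hδ1 n).trans this))
  obtain ⟨c, hc0, hc⟩ := ENNReal.exists_pos_sum_of_countable (ε := 1) one_ne_zero ℤ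
  have hcm : Measurable fun t : ℝ => (c ⌊t⌋ : ℝ) :=
    (measurable_of_countable fun k : ℤ => (c k : ℝ)).comp Int.measurable_floor
  have hgm := measurable_dampingFactor (τ := τ) hE
  have hgpos : ∀ᵐ t : ℝ, 0 < dampingFactor E τ t := by
    have hsum : ∑' n, periodMeasure (E n) ≠ ∞ := by
      refine ne_top_of_le_ne_top ?_ (ENNReal.tsum_le_tsum hEm)
      rw [← ENNReal.ofReal_tsum_of_nonneg (fun n => (hδ n).le) summable_geometric_two]
      exact ENNReal.ofReal_ne_top
    filter_upwards [ae_fract_of_ae_periodMeasure (ae_eventually_notMem hsum)] with t ht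
    exact dampingFactor_pos hτ ht
  let w : ℝ → ℝ := fun t => min (w₀ t) (c ⌊t⌋) * dampingFactor E τ t
  have hwpos : ∀ᵐ t : ℝ, 0 < w t := by
    filter_upwards [hw₀.2, hgpos] with t h1 h2
    exact mul_pos (lt_min h1 (by exact_mod_cast hc0 _)) h2
  have hwle : ∀ᵐ t : ℝ, w t ≤ w₀ t := by
    filter_upwards [hw₀.2] with t h1
    calc w t ≤ min (w₀ t) (c ⌊t⌋) * 1 := by
          have : (0 : ℝ) ≤ min (w₀ t) (c ⌊t⌋) := le_min h1.le (by positivity)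
          exact mul_le_mul_of_nonneg_left (dampingFactor_le_one hτ hτ1 t) this
      _ ≤ w₀ t := by rw [mul_one]; exact min_le_left _ _
  have hwd : ∀ᵐ t : ℝ, ENNReal.ofReal (w t) ≤ c ⌊t⌋ * ENNReal.ofReal (dampingFactor E τ t) := by
    filter_upwards [hgpos] with t ht
    calc ENNReal.ofReal (w t) ≤ ENNReal.ofReal (c ⌊t⌋ * dampingFactor E τ t) := by
          apply ENNReal.ofReal_le_ofReal
          exact mul_le_mul_of_nonneg_right (min_le_right _ _) ht.le
      _ = _ := by rw [ENNReal.ofReal_mul (by positivity), ENNReal.ofReal_coe_nnreal]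
  have hwi : Integrable w := by
    refine hw₀.1.mono' ((hw₀.1.aestronglyMeasurable.inf hcm.aestronglyMeasurable).mul
      hgm.aestronglyMeasurable) ?_
    filter_upwards [hwpos, hwle] with t h1 h2
    rwa [Real.norm_of_nonneg h1.le]
  have hbound : ∀ n {f : ℝ → ℂ}, Measurable f → (∀ t, f (Int.fract t) = f t) → (∀ t, ‖f t‖ ≤ D n) →
      eLpNorm f 2 (weightMeasure w) ≤ eLpNorm f 2 (periodMeasure.restrict (E n)ᶜ)
        + ENNReal.ofReal ((1 / 2) ^ n) := by
    intro n f hf hper hfD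
    refine (eLpNorm_le_dampedMeasure hE hc.le hwd hf hper).trans ?_
    rw [← hτD, ENNReal.ofReal_mul (by positivity)]
    exact eLpNorm_dampedMeasure_le hE hτ hτ1 n hf hfD
  have hfract : ∀ t : ℝ, expFun 1 (Int.fract t) = expFun 1 t := fun t => by
    rw [← expFun_one_add_int (Int.fract t) ⌊t⌋, Int.fract_add_floor]
  have hcs : ∀ n (z : ℂ), ‖z‖ₑ ≤ coeffSum (Y n) → ‖z‖ ≤ (coeffSum (Y n)).toReal := fun n z h => by
    simpa using ENNReal.toReal_mono (coeffSum_ne_top _) h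
  refine ⟨w, ⟨hwi, hwpos⟩, hwle, fun n => ⟨Y n, hY n, ?_, fun m => ?_⟩⟩
  · refine (hbound n (f := fun t => 1 - (Y n).eval (expFun 1 t))
      (continuous_const.sub (continuous_eval_expFun _)).measurable
      (fun t => by rw [hfract]) fun t => ?_).trans ?_
    · refine (norm_sub_le _ _).trans ?_
      rw [norm_one]
      exact add_le_add le_rfl (hcs n _ (enorm_eval_le_coeffSum _ (norm_expFun 1 t)))
    · rw [two_mul, ENNReal.ofReal_add (hδ n).le (hδ n).le]
      gcongr
      exact hY1 n
  · refine (hbound n (continuous_eval_expFun _).measurable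
      (fun t => by rw [hfract]) fun t => ?_).trans ?_
    · exact (hcs n _ (enorm_eval_lowPart_le_coeffSum m _ (norm_expFun 1 t))).trans (by simp [D])
    · calc _ ≤ (5 : ℝ≥0∞) + ENNReal.ofReal 1 := by
            gcongr
            · exact hlow n m
            · exact hδ1 n
        _ = 6 := by norm_num

end circle

section approximation

variable {H : Type*} [NormedAddCommGroup H] [InnerProductSpace ℂ H] {x : ℝ → H}

/-- The linear combination of the vectors `x λ` given by a list of pairs `(λ, c)`. -/
noncomputable def linearCombList (x : ℝ → H) (l : List (ℝ × ℂ)) : H :=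
  (l.map fun p => p.2 • x p.1).sum

/-- `u` is within `ε` of linear combinations of vectors `x λ` with arbitrarily large `1`-separated
increasing `λ` and with partial sums bounded by `K`. -/
def TailApprox (x : ℝ → H) (u : H) (K ε : ℝ) : Prop :=
  ∀ B : ℝ, ∃ l : List (ℝ × ℂ), l ≠ [] ∧ (∀ p ∈ l, B ≤ p.1) ∧
    l.Pairwise (fun p p' => p.1 + 1 ≤ p'.1) ∧ ‖u - linearCombList x l‖ ≤ ε ∧
    ∀ l', l' <+: l → ‖linearCombList x l'‖ ≤ K

theorem linearCombList_nil : linearCombList x [] = 0 := rfl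

theorem linearCombList_append (l₁ l₂ : List (ℝ × ℂ)) :
    linearCombList x (l₁ ++ l₂) = linearCombList x l₁ + linearCombList x l₂ := by
  simp [linearCombList]

theorem linearCombList_map_smul (c : ℂ) (l : List (ℝ × ℂ)) :
    linearCombList x (l.map fun p => (p.1, c * p.2)) = c • linearCombList x l := by
  induction l with
  | nil => simp [linearCombList]
  | cons p l ih =>
    simp only [linearCombList, List.map_cons, List.sum_cons, smul_add, mul_smul] at ih ⊢
    rw [ih]

theorem exists_upper_bound_list (l : List (ℝ × ℂ)) : ∃ B : ℝ, ∀ p ∈ l, p.1 + 1 ≤ B := by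
  obtain ⟨B, hB⟩ := ((l.toFinset.image fun p : ℝ × ℂ => p.1 + 1).finite_toSet).bddAbove
  exact ⟨B, fun p hp => hB (Finset.mem_coe.2
    (Finset.mem_image_of_mem _ (List.mem_toFinset.2 hp)))⟩

namespace TailApprox

variable {u v : H} {K K' ε ε' : ℝ}

theorem nonneg_bound (h : TailApprox x u K ε) : 0 ≤ K := by
  obtain ⟨l, -, -, -, -, hl⟩ := h 0
  simpa [linearCombList_nil] using hl [] List.nil_prefix

theorem mono (h : TailApprox x u K ε) (hK : K ≤ K') (hε : ε ≤ ε') : TailApprox x u K' ε' := by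
  intro B
  obtain ⟨l, h0, h1, h2, h3, h4⟩ := h B
  exact ⟨l, h0, h1, h2, h3.trans hε, fun l' hl' => (h4 l' hl').trans hK⟩

theorem of_norm_sub_le (h : TailApprox x u K ε) {δ : ℝ} (hv : ‖v - u‖ ≤ δ) :
    TailApprox x v K (δ + ε) := by
  intro B
  obtain ⟨l, h0, h1, h2, h3, h4⟩ := h B
  refine ⟨l, h0, h1, h2, ?_, h4⟩
  calc ‖v - linearCombList x l‖ = ‖(v - u) + (u - linearCombList x l)‖ := by congr 1; abel
    _ ≤ δ + ε := (norm_add_le _ _).trans (add_le_add hv h3)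

theorem zero : TailApprox x 0 0 0 := by
  intro B
  refine ⟨[(B, 0)], by simp, by simp, by simp, by simp [linearCombList], fun l' hl' => ?_⟩
  rcases List.prefix_cons_iff.1 hl' with rfl | ⟨t, rfl, ht⟩
  · simp [linearCombList]
  · rw [List.prefix_nil.1 ht]
    simp [linearCombList]

theorem smul (h : TailApprox x u K ε) (c : ℂ) : TailApprox x (c • u) (‖c‖ * K) (‖c‖ * ε) := by
  intro B
  obtain ⟨l, h0, h1, h2, h3, h4⟩ := h B
  refine ⟨l.map fun p => (p.1, c * p.2), by simpa using h0, ?_, ?_, ?_, fun l' hl' => ?_⟩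
  · intro p hp
    obtain ⟨p', hp', rfl⟩ := List.mem_map.1 hp
    exact h1 p' hp'
  · exact List.pairwise_map.2 h2
  · rw [linearCombList_map_smul, ← smul_sub, norm_smul]
    gcongr
  · obtain ⟨l'', hl'', rfl⟩ := List.prefix_map_iff.1 hl'
    rw [linearCombList_map_smul, norm_smul]
    gcongr
    exact h4 l'' hl''

theorem add {K'' : ℝ} (hu : TailApprox x u K ε) (hv : TailApprox x v K' ε') (h1 : K ≤ K'')
    (h2 : ‖u‖ + ε + K' ≤ K'') : TailApprox x (u + v) K'' (ε + ε') := by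
  intro B
  obtain ⟨l, l0, l1, l2, l3, l4⟩ := hu B
  obtain ⟨B', hB'⟩ := exists_upper_bound_list l
  obtain ⟨m, m0, m1, m2, m3, m4⟩ := hv (max B B')
  refine ⟨l ++ m, by simp [l0], ?_, ?_, ?_, ?_⟩
  · intro p hp
    rcases List.mem_append.1 hp with hp | hp
    · exact l1 p hp
    · exact (le_max_left _ _).trans (m1 p hp)
  · exact List.pairwise_append.2 ⟨l2, m2, fun a ha b hb =>
      (hB' a ha).trans ((le_max_right _ _).trans (m1 b hb))⟩
  · rw [linearCombList_append, add_sub_add_comm]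
    exact (norm_add_le _ _).trans (add_le_add l3 m3)
  · intro l' hl'
    rcases List.prefix_or_prefix_of_prefix hl' (List.prefix_append l m) with h | ⟨t, rfl⟩
    · exact (l4 l' h).trans h1
    · have ht : t <+: m := (List.prefix_append_right_inj l).1 hl'
      rw [linearCombList_append]
      refine le_trans (norm_add_le _ _) (le_trans (add_le_add ?_ (m4 t ht)) h2)
      calc ‖linearCombList x l‖ = ‖u - (u - linearCombList x l)‖ := by rw [sub_sub_cancel]
        _ ≤ ‖u‖ + ε := (norm_sub_le _ _).trans (by gcongr)

/-- Splitting `u` into many equal summands makes the bound for the partial sums almost optimal. -/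
theorem average (h : TailApprox x u K ε) {δ : ℝ} (hδ : 0 < δ) :
    TailApprox x u (‖u‖ + ε + δ) ε := by
  have hK := h.nonneg_bound
  have hε : 0 ≤ ε := by
    obtain ⟨l, -, -, -, hl, -⟩ := h 0
    exact (norm_nonneg _).trans hl
  obtain ⟨M, hM⟩ := exists_nat_gt (K / δ)
  have hM0 : (0 : ℝ) < M := lt_of_le_of_lt (by positivity) hM
  have hKM : K / M ≤ δ := by
    rw [div_lt_iff₀ hδ] at hM
    rw [div_le_iff₀ hM0]
    linarith
  have hn : ‖(1 / M : ℂ)‖ = 1 / M := by simp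
  have h1 := h.smul (1 / M : ℂ)
  rw [hn] at h1
  have key : ∀ m : ℕ, TailApprox x ((m / M : ℂ) • u) ((m / M) * (‖u‖ + ε) + K / M) (m / M * ε) := by
    intro m
    induction m with
    | zero =>
      have : (0 : ℝ) ≤ K / M := by positivity
      simpa using zero.mono this le_rfl
    | succ m ih =>
      have e1 : (((m + 1 : ℕ) : ℂ) / M) • u = (m / M : ℂ) • u + (1 / M : ℂ) • u := by
        rw [← add_smul]
        congr 1
        push_cast
        ring
      have e2 : ((m + 1 : ℕ) : ℝ) / M * ε = m / M * ε + 1 / M * ε := by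
        push_cast
        ring
      have e3 : ((m + 1 : ℕ) : ℝ) / M * (‖u‖ + ε) = m / M * (‖u‖ + ε) + 1 / M * (‖u‖ + ε) := by
        push_cast
        ring
      have e4 : ‖(m / M : ℂ) • u‖ = m / M * ‖u‖ := by simp [norm_smul]
      have e5 : 0 ≤ 1 / M * (‖u‖ + ε) := by positivity
      rw [e1, e2, e3]
      refine ih.add h1 ?_ ?_
      · linarith
      · rw [e4, one_div_mul_eq_div]
        linarith
  have := key M
  rw [div_self (by exact_mod_cast hM0.ne'), div_self hM0.ne'] at this
  simp only [one_smul, one_mul] at this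
  exact this.mono (by linarith) le_rfl

end TailApprox

theorem tailApprox_of_mem_span {s : Set H} (hs : ∀ u ∈ s, ∃ K, ∀ ε > 0, TailApprox x u K ε) {u : H}
    (hu : u ∈ Submodule.span ℂ s) : ∃ K, ∀ ε > 0, TailApprox x u K ε := by
  induction hu using Submodule.span_induction with
  | mem u hu => exact hs u hu
  | zero => exact ⟨0, fun ε hε => TailApprox.zero.mono le_rfl hε.le⟩
  | add u v _ _ hu hv =>
    obtain ⟨K, hK⟩ := hu
    obtain ⟨K', hK'⟩ := hv
    have h0 := (hK 1 one_pos).nonneg_bound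
    have h0' := (hK' 1 one_pos).nonneg_bound
    refine ⟨‖u‖ + 1 + K + K', fun ε hε => ?_⟩
    have h1 : 0 < min (ε / 2) 1 := lt_min (by linarith) one_pos
    refine ((hK _ h1).add (hK' _ h1) (K'' := ‖u‖ + 1 + K + K') ?_ ?_).mono le_rfl ?_
    · have := norm_nonneg u
      linarith
    · linarith [min_le_right (ε / 2) 1]
    · linarith [min_le_left (ε / 2) 1]
  | smul c u _ hu =>
    obtain ⟨K, hK⟩ := hu
    refine ⟨‖c‖ * K, fun ε hε => ?_⟩
    have hc : 0 < ‖c‖ + 1 := by positivity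
    refine ((hK (ε / (‖c‖ + 1)) (by positivity)).smul c).mono le_rfl ?_
    rw [mul_div_assoc', div_le_iff₀ hc]
    nlinarith

theorem tailApprox_of_dense_span {s : Set H} (hs : ∀ u ∈ s, ∃ K, ∀ ε > 0, TailApprox x u K ε)
    (hd : (Submodule.span ℂ s).topologicalClosure = ⊤) (u : H) {ε : ℝ} (hε : 0 < ε) :
    TailApprox x u (‖u‖ + ε) ε := by
  have hu : u ∈ (Submodule.span ℂ s).topologicalClosure := by rw [hd]; trivial
  obtain ⟨v, hv, hvu⟩ := Metric.mem_closure_iff.1 hu (ε / 4) (by linarith)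
  obtain ⟨K, hK⟩ := tailApprox_of_mem_span hs hv
  rw [dist_eq_norm] at hvu
  have h1 : ‖v‖ ≤ ‖u‖ + ε / 4 := by
    calc ‖v‖ = ‖u - (u - v)‖ := by rw [sub_sub_cancel]
      _ ≤ _ := (norm_sub_le _ _).trans (by gcongr)
  have h4 : 0 < ε / 4 := by linarith
  exact (((hK (ε / 4) h4).average h4).of_norm_sub_le hvu.le).mono (by linarith) (by linarith)

end approximation

/-- In a separable Hilbert space there is a sequence consisting of an orthonormal basis and possibly
of zero vectors. -/
theorem exists_orthonormal_expansion (H : Type*) [NormedAddCommGroup H] [InnerProductSpace ℂ H]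
    [CompleteSpace H] [TopologicalSpace.SeparableSpace H] :
    ∃ b : ℕ → H, (∀ n, b n = 0 ∨ ‖b n‖ = 1) ∧ ∀ f, HasSum (fun n => inner ℂ (b n) f • b n) f := by
  obtain ⟨s, b, -⟩ := exists_hilbertBasis ℂ H
  have hb := b.orthonormal
  have hdisj : Pairwise (Function.onFun Disjoint fun i => Metric.ball (b i) (1 / 2)) := by
    intro i j hij
    refine Metric.ball_disjoint_ball ?_
    have h := norm_sub_sq (𝕜 := ℂ) (b i) (b j)
    rw [hb.2 hij, hb.1 i, hb.1 j] at h
    rw [dist_eq_norm]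
    simp only [map_zero] at h
    nlinarith [norm_nonneg (b i - b j)]
  have : Countable s := hdisj.countable_of_isOpen_disjoint (fun i => Metric.isOpen_ball)
    (fun i => ⟨b i, Metric.mem_ball_self (by norm_num)⟩)
  obtain ⟨e, he⟩ := exists_injective_nat s
  refine ⟨Function.extend e b 0, fun n => ?_, fun f => ?_⟩
  · by_cases hn : ∃ i, e i = n
    · obtain ⟨i, rfl⟩ := hn
      rw [he.extend_apply]
      exact Or.inr (hb.1 i)
    · rw [Function.extend_apply' _ _ _ hn]
      exact Or.inl rfl
  · refine (he.hasSum_iff fun n hn => ?_).1 ?_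
    · rw [Function.extend_apply' _ _ _ hn]
      simp
    · have := b.hasSum_repr f
      simp only [b.repr_apply_apply] at this
      simpa [Function.comp_def, he.extend_apply] using this

theorem prefix_of_le {α : Type*} {L : ℕ → List α} (hL : ∀ n, L n <+: L (n + 1)) {m n : ℕ}
    (h : m ≤ n) : L m <+: L n := by
  induction h with
  | refl => exact List.prefix_rfl
  | step _ ih => exact ih.trans (hL _)

/-- The limit of an increasing sequence of lists. -/
theorem exists_limit_of_prefixes {α : Type*} [Inhabited α] (L : ℕ → List α)
    (hL : ∀ n, L n <+: L (n + 1)) (hlen : ∀ n, n ≤ (L n).length) :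
    ∃ a : ℕ → α, ∀ N, (List.range N).map a = (L N).take N := by
  refine ⟨fun j => (L (j + 1)).getD j default, fun N => ?_⟩
  refine List.ext_getElem (by simp [hlen N]) fun j h1 h2 => ?_
  have hj : j < N := by simpa using h1
  have hj' : j < (L (j + 1)).length := lt_of_lt_of_le (Nat.lt_succ_self j) (hlen _)
  rw [List.getElem_map, List.getElem_range, List.getElem_take, List.getD_eq_getElem _ _ hj']
  exact (prefix_of_le hL hj).getElem hj'

theorem prefix_concat_cases {α : Type*} {L M : ℕ → List α} (hL : ∀ n, L (n + 1) = L n ++ M n)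
    (n₀ N : ℕ) {l : List α} (hl : l <+: L N) :
    l <+: L n₀ ∨ ∃ n ≥ n₀, ∃ l', l' <+: M n ∧ l = L n ++ l' := by
  have hstep : ∀ n, L n <+: L (n + 1) := fun n => by
    rw [hL]
    exact List.prefix_append _ _
  induction N with
  | zero => exact Or.inl (hl.trans (prefix_of_le hstep (Nat.zero_le n₀)))
  | succ N ih =>
    by_cases hN : n₀ ≤ N
    · rw [hL] at hl
      rcases List.prefix_or_prefix_of_prefix hl (List.prefix_append _ _) with h | ⟨t, rfl⟩
      · exact ih h
      · exact Or.inr ⟨N, hN, t, (List.prefix_append_right_inj _).1 hl, rfl⟩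
    · exact Or.inl (hl.trans (prefix_of_le hstep (by omega)))

section frame

variable {H : Type*} [NormedAddCommGroup H] [InnerProductSpace ℂ H] {x : ℝ → H}

/-- The operator `g ↦ ∑ ⟨v, g⟩ x λ`, the sum being over the pairs `(λ, v)` of a list. -/
noncomputable def expansionList (x : ℝ → H) (L : List (ℝ × H)) (g : H) : H :=
  (L.map fun p => inner ℂ p.2 g • x p.1).sum

theorem expansionList_append (L M : List (ℝ × H)) (g : H) :
    expansionList x (L ++ M) g = expansionList x L g + expansionList x M g := by
  simp [expansionList]

theorem expansionList_map (l : List (ℝ × ℂ)) (b g : H) :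
    expansionList x (l.map fun p => (p.1, conj p.2 • b)) g = inner ℂ b g • linearCombList x l := by
  induction l with
  | nil => simp [expansionList, linearCombList]
  | cons p l ih =>
    simp only [expansionList, linearCombList, List.map_cons, List.sum_cons, smul_add,
      inner_smul_left, Complex.conj_conj, smul_smul] at ih ⊢
    rw [ih, mul_comm]

variable [CompleteSpace H]

/-- A small perturbation of an orthonormal expansion: the operator `g ↦ ∑ ⟨b n, g⟩ y n` is
invertible. -/
theorem exists_inverse_of_perturbation {b y : ℕ → H} (hb : ∀ n, b n = 0 ∨ ‖b n‖ = 1)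
    (hsum : ∀ f, HasSum (fun n => inner ℂ (b n) f • b n) f)
    (hy : ∀ n, ‖b n - y n‖ ≤ (1 / 2) ^ (n + 2)) :
    ∃ R : H →L[ℂ] H, ∀ f, HasSum (fun n => inner ℂ (b n) (R f) • y n) f := by
  have hb1 : ∀ n, ‖b n‖ ≤ 1 := fun n => by rcases hb n with h | h <;> simp [h]
  let T : ℕ → H →L[ℂ] H := fun n => (innerSL ℂ (b n)).smulRight (b n - y n)
  have hT : ∀ n, ‖T n‖ ≤ (1 / 2) ^ (n + 2) := fun n => by
    simp only [T, ContinuousLinearMap.norm_smulRight_apply, innerSL_apply_norm]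
    calc ‖b n‖ * ‖b n - y n‖ ≤ 1 * (1 / 2) ^ (n + 2) := by
          gcongr
          · exact hb1 n
          · exact hy n
      _ = _ := one_mul _
  have hgeo : HasSum (fun n : ℕ => ((1 : ℝ) / 2) ^ (n + 2)) (1 / 2) := by
    have := hasSum_geometric_two.mul_right ((1 / 2 : ℝ) ^ 2)
    simp only [← pow_add] at this
    norm_num at this ⊢
    exact this
  have hTs : Summable T := Summable.of_norm_bounded hgeo.summable hT
  have hTn : ‖∑' n, T n‖ < 1 :=
    (tsum_of_norm_bounded hgeo hT).trans_lt (by norm_num)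
  let U := Units.oneSub (∑' n, T n) hTn
  refine ⟨(U⁻¹ : (H →L[ℂ] H)ˣ), fun f => ?_⟩
  set g := ((U⁻¹ : (H →L[ℂ] H)ˣ) : H →L[ℂ] H) f
  have hUg : (U : H →L[ℂ] H) g = f := by
    change ((U : H →L[ℂ] H) * ((U⁻¹ : (H →L[ℂ] H)ˣ) : H →L[ℂ] H)) f = f
    rw [Units.mul_inv]
    rfl
  have h1 : HasSum (fun n => T n g) ((∑' n, T n) g) :=
    hTs.hasSum.mapL (ContinuousLinearMap.apply ℂ H g)
  have h2 := (hsum g).sub h1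
  have h3 : g - (∑' n, T n) g = f := by
    rw [← hUg]
    simp [U]
  rw [h3] at h2
  convert h2 using 2 with n
  simp [T, smul_sub]

/-- If every vector can be approximated by linear combinations of vectors `x λ` with arbitrarily
large separated `λ` and controlled partial sums, then there are a separated sequence `lam` and vectors
`e j` such that `f = ∑ ⟨e j, f⟩ x (lam j)` for all `f`. -/
theorem exists_expansion_of_tailApprox [TopologicalSpace.SeparableSpace H]
    (hx : ∀ (u : H) (ε : ℝ), 0 < ε → TailApprox x u (‖u‖ + ε) ε) :
    ∃ (lam : ℕ → ℝ) (e : ℕ → H), (∀ i j, i < j → lam i + 1 ≤ lam j) ∧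
      ∀ f, Tendsto (fun N => ∑ j ∈ Finset.range N, inner ℂ (e j) f • x (lam j)) atTop (𝓝 f) := by
  obtain ⟨b, hb, hbsum⟩ := exists_orthonormal_expansion H
  have hb1 : ∀ n, ‖b n‖ ≤ 1 := fun n => by rcases hb n with h | h <;> simp [h]
  have hε : ∀ n : ℕ, (0 : ℝ) < (1 / 2) ^ (n + 2) := fun n => by positivity
  have hε1 : ∀ n : ℕ, ((1 : ℝ) / 2) ^ (n + 2) ≤ 1 := fun n =>
    pow_le_one₀ (by norm_num) (by norm_num)
  choose block hne hge hpw hnear hpre using fun n => hx (b n) _ (hε n)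
  choose ub hub using exists_upper_bound_list
  let B : ℕ → ℝ := fun n => Nat.rec 0 (fun n B => ub (block n B)) n
  let l : ℕ → List (ℝ × ℂ) := fun n => block n (B n)
  have hB : ∀ n, ∀ p ∈ l n, B n ≤ p.1 ∧ p.1 + 1 ≤ B (n + 1) := fun n p hp =>
    ⟨hge n _ p hp, hub _ p hp⟩
  have hBmono : ∀ n, B n ≤ B (n + 1) := fun n => by
    obtain ⟨p, hp⟩ := List.exists_mem_of_ne_nil _ (hne n (B n))
    linarith [(hB n p hp).1, (hB n p hp).2]
  obtain ⟨R, hR⟩ := exists_inverse_of_perturbation (y := fun n => linearCombList x (l n)) hb hbsum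
    fun n => hnear n _
  let M : ℕ → List (ℝ × H) := fun n => (l n).map fun p => (p.1, conj p.2 • b n)
  let L : ℕ → List (ℝ × H) := fun n => Nat.rec [] (fun n L => L ++ M n) n
  have hL : ∀ n, L (n + 1) = L n ++ M n := fun n => rfl
  have hLpre : ∀ n, L n <+: L (n + 1) := fun n => List.prefix_append _ _
  have hlen : ∀ n, n ≤ (L n).length := fun n => by
    induction n with
    | zero => simp
    | succ n ih =>
      have : 0 < (M n).length := by simpa [M] using List.length_pos_iff.2 (hne n (B n))
      rw [hL, List.length_append]
      omega
  have hMB : ∀ n, ∀ p ∈ M n, B n ≤ p.1 ∧ p.1 + 1 ≤ B (n + 1) := fun n p hp => by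
    obtain ⟨p', hp', rfl⟩ := List.mem_map.1 hp
    exact hB n p' hp'
  have hLB : ∀ n, ∀ p ∈ L n, p.1 + 1 ≤ B n := fun n => by
    induction n with
    | zero => simp [L]
    | succ n ih =>
      intro p hp
      rcases List.mem_append.1 hp with hp | hp
      · exact (ih p hp).trans (hBmono n)
      · exact (hMB n p hp).2
  have hLpw : ∀ n, (L n).Pairwise (fun p p' => p.1 + 1 ≤ p'.1) := fun n => by
    induction n with
    | zero => simp [L]
    | succ n ih =>
      refine List.pairwise_append.2 ⟨ih, List.pairwise_map.2 (hpw n _), fun p hp p' hp' => ?_⟩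
      exact (hLB n p hp).trans (hMB n p' hp').1
  have hLsum : ∀ n g, expansionList x (L n) g
      = ∑ k ∈ Finset.range n, inner ℂ (b k) g • linearCombList x (l k) := fun n g => by
    induction n with
    | zero => simp [L, expansionList]
    | succ n ih => rw [hL, expansionList_append, ih, expansionList_map, Finset.sum_range_succ]
  have : Inhabited (ℝ × H) := ⟨0⟩
  obtain ⟨a, ha⟩ := exists_limit_of_prefixes L hLpre hlen
  refine ⟨fun j => (a j).1, fun j => ContinuousLinearMap.adjoint R (a j).2, fun i j hij => ?_,
    fun f => ?_⟩
  · have h := (hLpw (j + 1)).sublist (List.take_sublist (j + 1) _)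
    rw [← ha, List.pairwise_map, List.pairwise_iff_getElem] at h
    have hi : i < (List.range (j + 1)).length := by rw [List.length_range]; omega
    have hj : j < (List.range (j + 1)).length := by simp
    have := h i j hi hj hij
    rwa [List.getElem_range, List.getElem_range] at this
  have hpartial : ∀ N, ∑ j ∈ Finset.range N,
      inner ℂ (ContinuousLinearMap.adjoint R (a j).2) f • x (a j).1
        = expansionList x ((L N).take N) (R f) := fun N => by
    rw [← ha, expansionList, List.map_map, Finset.sum_range]
    simp only [ContinuousLinearMap.adjoint_inner_left]
    rw [← List.sum_ofFn, List.ofFn_eq_map, ← List.map_coe_finRange_eq_range, List.map_map]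
    rfl
  have hcoef : Tendsto (fun n => ‖inner ℂ (b n) (R f)‖) atTop (𝓝 0) := by
    have h := (hbsum (R f)).summable.tendsto_atTop_zero.norm
    rw [norm_zero] at h
    refine h.congr fun n => ?_
    rcases hb n with h | h <;> simp [norm_smul, h]
  have hmain := (hR f).tendsto_sum_nat
  rw [Metric.tendsto_atTop] at hmain hcoef ⊢
  intro ε hε0
  obtain ⟨n₁, hn₁⟩ := hmain (ε / 2) (by linarith)
  obtain ⟨n₂, hn₂⟩ := hcoef (ε / 4) (by linarith)
  refine ⟨(L (max n₁ n₂)).length + 1, fun N hN => ?_⟩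
  rw [hpartial]
  have hlenN : ((L N).take N).length = N := by simp [hlen N]
  rcases prefix_concat_cases hL (max n₁ n₂) N (List.take_prefix N (L N)) with h | ⟨n, hn, l', hl', h⟩
  · have := h.length_le
    omega
  · obtain ⟨l'', hl'', rfl⟩ := List.prefix_map_iff.1 hl'
    rw [h, expansionList_append, hLsum, expansionList_map, dist_eq_norm, add_sub_right_comm]
    have h1 := hn₁ n ((le_max_left _ _).trans hn)
    have h2 := hn₂ n ((le_max_right _ _).trans hn)
    rw [dist_eq_norm] at h1
    rw [Real.dist_0_eq_abs, abs_norm] at h2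
    have h3 : ‖linearCombList x l''‖ ≤ 2 :=
      (hpre n _ l'' hl'').trans (by linarith [hb1 n, hε1 n])
    calc _ ≤ _ := norm_add_le _ _
      _ ≤ _ := add_le_add_right (norm_smul_le _ _) _
      _ ≤ ‖∑ k ∈ Finset.range n, inner ℂ (b k) (R f) • linearCombList x (l k) - f‖
          + ‖inner ℂ (b n) (R f)‖ * 2 := by gcongr
      _ < ε := by linarith

end frame

section density

open Polynomial

theorem integrable_expFun_mul {μ : Measure ℝ} (α : ℝ) {g : ℝ → ℂ} (hg : Integrable g μ) :
    Integrable (fun t => expFun α t * g t) μ :=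
  hg.bdd_mul (continuous_expFun α).aestronglyMeasurable
    (Eventually.of_forall fun t => (norm_expFun α t).le)

theorem charFun_eq_integral_expFun (ν : Measure ℝ) (s : ℝ) :
    charFun ν s = ∫ t, expFun (s / (2 * Real.pi)) t ∂ν := by
  rw [charFun_apply_real]
  congr 1 with t
  rw [expFun]
  congr 1
  have : (Real.pi : ℂ) ≠ 0 := by exact_mod_cast Real.pi_ne_zero
  push_cast
  field_simp

theorem conj_expFun (α t : ℝ) : conj (expFun α t) = expFun (-α) t := by
  rw [expFun, expFun, ← Complex.exp_conj]
  simp [map_ofNat]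

theorem ae_eq_zero_of_integral_expFun_mul_ofReal {μ : Measure ℝ} {h : ℝ → ℝ} (hh : Integrable h μ)
    (h0 : ∀ α, ∫ t, expFun α t * (h t : ℂ) ∂μ = 0) : h =ᵐ[μ] 0 := by
  have hfin : ∀ {k : ℝ → ℝ}, Integrable k μ →
      IsFiniteMeasure (μ.withDensity fun t => ENNReal.ofReal (k t)) :=
    fun hk => isFiniteMeasure_withDensity_ofReal hk.2
  have hchar : ∀ {k : ℝ → ℝ}, Integrable k μ → ∀ s,
      charFun (μ.withDensity fun t => ENNReal.ofReal (k t)) s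
        = ∫ t, expFun (s / (2 * Real.pi)) t * ((max (k t) 0 : ℝ) : ℂ) ∂μ := by
    intro k hk s
    rw [charFun_eq_integral_expFun, integral_withDensity_eq_integral_toReal_smul₀
      hk.aemeasurable.ennreal_ofReal (by simp)]
    congr 1 with t
    rw [ENNReal.toReal_ofReal', Complex.real_smul, mul_comm]
  have := hfin hh
  have := hfin hh.neg
  have heq : μ.withDensity (fun t => ENNReal.ofReal (h t))
      = μ.withDensity (fun t => ENNReal.ofReal ((-h) t)) := by
    refine Measure.ext_of_charFun (funext fun s => ?_)
    have hp : ∀ {k : ℝ → ℝ}, Integrable k μ → Integrable (fun t => ((max (k t) 0 : ℝ) : ℂ)) μ :=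
      fun hk => hk.pos_part.ofReal
    rw [hchar hh, hchar hh.neg, ← sub_eq_zero, ← integral_sub
      (integrable_expFun_mul _ (hp hh)) (integrable_expFun_mul _ (hp hh.neg)),
      ← h0 (s / (2 * Real.pi))]
    congr 1 with t
    rw [← mul_sub, ← Complex.ofReal_sub]
    congr 2
    exact max_zero_sub_max_neg_zero_eq_self (h t)
  rw [withDensity_eq_iff hh.aemeasurable.ennreal_ofReal hh.neg.aemeasurable.ennreal_ofReal
    hh.lintegral_lt_top.ne] at heq
  filter_upwards [heq] with t ht
  rcases le_total (h t) 0 with h1 | h1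
  · rw [ENNReal.ofReal_of_nonpos h1, eq_comm, ENNReal.ofReal_eq_zero] at ht
    simp only [Pi.neg_apply] at ht
    simp only [Pi.zero_apply]
    linarith
  · rw [ENNReal.ofReal_of_nonpos (by simpa using h1 : (-h) t ≤ 0), ENNReal.ofReal_eq_zero] at ht
    simp only [Pi.zero_apply]
    linarith

theorem ae_eq_zero_of_integral_expFun_mul {μ : Measure ℝ} {g : ℝ → ℂ} (hg : Integrable g μ)
    (h0 : ∀ α, ∫ t, expFun α t * g t ∂μ = 0) : g =ᵐ[μ] 0 := by
  have hgc : Integrable (fun t => conj (g t)) μ :=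
    (Complex.conjLIE.integrable_comp_iff).2 hg
  have h1 : ∀ α, ∫ t, expFun α t * conj (g t) ∂μ = 0 := by
    intro α
    have h := congrArg conj (h0 (-α))
    rw [← integral_conj, map_zero] at h
    simpa [conj_expFun] using h
  have hre := ae_eq_zero_of_integral_expFun_mul_ofReal (h := fun t => (g t).re) hg.re fun α => by
    have h2 : ∀ t, expFun α t * ((g t).re : ℂ)
        = (1 / 2) * (expFun α t * g t) + (1 / 2) * (expFun α t * conj (g t)) := fun t => by
      rw [Complex.re_eq_add_conj]; ring
    simp_rw [h2]
    rw [integral_add ((integrable_expFun_mul α hg).const_mul _)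
      ((integrable_expFun_mul α hgc).const_mul _), integral_const_mul, integral_const_mul, h0, h1]
    simp
  have him := ae_eq_zero_of_integral_expFun_mul_ofReal (h := fun t => (g t).im) hg.im fun α => by
    have h2 : ∀ t, expFun α t * ((g t).im : ℂ)
        = (1 / (2 * Complex.I)) * (expFun α t * g t)
          - (1 / (2 * Complex.I)) * (expFun α t * conj (g t)) := fun t => by
      rw [Complex.im_eq_sub_conj]; ring
    simp_rw [h2]
    rw [integral_sub ((integrable_expFun_mul α hg).const_mul _)
      ((integrable_expFun_mul α hgc).const_mul _), integral_const_mul, integral_const_mul, h0, h1]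
    simp
  filter_upwards [hre, him] with t h1 h2
  exact Complex.ext h1 h2

section exponentials

variable {μ : Measure ℝ} [IsFiniteMeasure μ]

theorem memLp_expFun (α : ℝ) : MemLp (expFun α) 2 μ :=
  MemLp.of_bound (continuous_expFun α).aestronglyMeasurable 1
    (Eventually.of_forall fun t => (norm_expFun α t).le)

variable (μ) in
/-- The exponential `expFun α` as an element of `L²(μ)`. -/
noncomputable def expLp (α : ℝ) : Lp ℂ 2 μ := (memLp_expFun α).toLp (expFun α)

/-- The exponentials span a dense subspace of `L²(μ)` for every finite measure `μ`. -/
theorem span_expLp_dense :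
    (Submodule.span ℂ (Set.range (expLp μ))).topologicalClosure = ⊤ := by
  rw [Submodule.topologicalClosure_eq_top_iff, Submodule.eq_bot_iff]
  intro g hg
  have hg0 : ∀ α, ∫ t, expFun α t * g t ∂μ = 0 := by
    intro α
    have h := (Submodule.mem_orthogonal _ _).1 hg (expLp μ (-α))
      (Submodule.subset_span ⟨_, rfl⟩)
    rw [L2.inner_def] at h
    rw [← h]
    refine integral_congr_ae ?_
    filter_upwards [(memLp_expFun (μ := μ) (-α)).coeFn_toLp] with t ht
    rw [expLp, ht, RCLike.inner_apply, conj_expFun, neg_neg, mul_comm]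
  have hgi : Integrable g μ := (Lp.memLp g).integrable (by norm_num)
  exact (Lp.eq_zero_iff_ae_eq_zero).2 (ae_eq_zero_of_integral_expFun_mul hgi hg0)

theorem coeFn_linearCombList_expLp {Y : ℂ[X]} {n : ℕ} (hY : X ^ n ∣ Y) (α : ℝ) (k : ℕ) :
    (linearCombList (expLp μ)
      ((List.range' n k).map fun j : ℕ => (α + (j : ℝ), Y.coeff j)) : Lp ℂ 2 μ) =ᵐ[μ]
      fun t => expFun α t * (lowPart (n + k) Y).eval (expFun 1 t) := by
  induction k with
  | zero =>
    rw [add_zero, lowPart_eq_zero hY le_rfl]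
    simp only [List.range'_zero, List.map_nil, linearCombList_nil, eval_zero, mul_zero]
    exact Lp.coeFn_zero ℂ 2 μ
  | succ k ih =>
    rw [List.range'_1_concat, List.map_append, linearCombList_append]
    have h1 : linearCombList (expLp μ) ([n + k].map fun j : ℕ => (α + (j : ℝ), Y.coeff j))
        = Y.coeff (n + k) • expLp μ (α + (n + k : ℕ)) := by simp [linearCombList]
    rw [h1]
    filter_upwards [Lp.coeFn_add (linearCombList (expLp μ)
        ((List.range' n k).map fun j : ℕ => (α + (j : ℝ), Y.coeff j)))
        (Y.coeff (n + k) • expLp μ (α + (n + k : ℕ))),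
      Lp.coeFn_smul (Y.coeff (n + k)) (expLp μ (α + (n + k : ℕ))), ih,
      (memLp_expFun (μ := μ) (α + (n + k : ℕ))).coeFn_toLp] with t h2 h3 h4 h5
    rw [h2, Pi.add_apply, h3, h4, Pi.smul_apply, expLp, h5, expFun_add, expFun_natCast, eval_lowPart,
      eval_lowPart, ← add_assoc, Finset.sum_range_succ, smul_eq_mul]
    ring

end exponentials

theorem isFiniteMeasure_weightMeasure {w : ℝ → ℝ} (hw : IsWeight w) :
    IsFiniteMeasure (weightMeasure w) :=
  isFiniteMeasure_withDensity_ofReal hw.1.2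

theorem tailApprox_expLp {μ : Measure ℝ} [IsFiniteMeasure μ]
    (hμ : ∀ n : ℕ, ∃ Y : ℂ[X], X ^ n ∣ Y ∧
      eLpNorm (fun t => 1 - Y.eval (expFun 1 t)) 2 μ ≤ ENNReal.ofReal (2 * (1 / 2) ^ n) ∧
      ∀ m, eLpNorm (fun t => (lowPart m Y).eval (expFun 1 t)) 2 μ ≤ 6)
    (α : ℝ) {ε : ℝ} (hε : 0 < ε) : TailApprox (expLp μ) (expLp μ α) 6 ε := by
  intro B
  have hlim : Tendsto (fun n : ℕ => 2 * ((1 : ℝ) / 2) ^ n) atTop (𝓝 0) := by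
    simpa using (tendsto_pow_atTop_nhds_zero_of_lt_one (by norm_num : (0 : ℝ) ≤ 1 / 2)
      (by norm_num)).const_mul 2
  obtain ⟨n, hnε, hnB⟩ := ((hlim.eventually (gt_mem_nhds hε)).and
    (tendsto_natCast_atTop_atTop.eventually_ge_atTop (B - α))).exists
  obtain ⟨Y, hY, hY1, hlow⟩ := hμ n
  refine ⟨(List.range' n (Y.natDegree + 1)).map fun j : ℕ => (α + (j : ℝ), Y.coeff j), by simp, ?_, ?_, ?_,
    fun l' hl' => ?_⟩
  · intro p hp
    obtain ⟨j, hj, rfl⟩ := List.mem_map.1 hp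
    have : (n : ℝ) ≤ j := by exact_mod_cast (List.mem_range'_1.1 hj).1
    change B ≤ α + j
    linarith
  · refine List.pairwise_map.2 ((List.pairwise_lt_range' _).imp fun {i j} hij => ?_)
    have : (i : ℝ) + 1 ≤ j := by exact_mod_cast hij
    change α + i + 1 ≤ α + j
    linarith
  · have h1 := coeFn_linearCombList_expLp (μ := μ) hY α (Y.natDegree + 1)
    rw [lowPart_eq_self (by omega)] at h1
    rw [Lp.norm_def]
    refine ENNReal.toReal_le_of_le_ofReal hε.le (le_trans (le_of_eq ?_)
      (hY1.trans (ENNReal.ofReal_le_ofReal hnε.le)))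
    refine eLpNorm_congr_norm_ae ?_
    filter_upwards [h1, (memLp_expFun (μ := μ) α).coeFn_toLp, Lp.coeFn_sub (expLp μ α)
      (linearCombList (expLp μ) ((List.range' n (Y.natDegree + 1)).map
        fun j : ℕ => (α + (j : ℝ), Y.coeff j)))] with t h1 h2 h3
    rw [h3, Pi.sub_apply, h1, expLp, h2, ← mul_one_sub, norm_mul, norm_expFun, one_mul]
  · obtain ⟨l, hl, rfl⟩ := List.prefix_map_iff.1 hl'
    have hlr : l = List.range' n l.length := by
      have := List.prefix_iff_eq_take.1 hl
      rwa [List.take_range'_of_length_ge (by simpa using hl.length_le)] at this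
    rw [hlr, Lp.norm_def]
    refine ENNReal.toReal_le_of_le_ofReal (by norm_num) (le_trans (le_of_eq ?_)
      ((hlow (n + l.length)).trans (by simp)))
    refine eLpNorm_congr_norm_ae ?_
    filter_upwards [coeFn_linearCombList_expLp (μ := μ) hY α l.length]
      with t h1
    rw [h1, norm_mul, norm_expFun, one_mul]

theorem weightedInner_eq_inner {w : ℝ → ℝ} (hw : IsWeight w) {f : ℝ → ℂ}
    (hf : MemLp f 2 (weightMeasure w)) (e : Lp ℂ 2 (weightMeasure w)) :
    weightedInner w f e = inner ℂ e (hf.toLp f) := by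
  have h1 : (inner ℂ e (hf.toLp f) : ℂ) = ∫ t, f t * conj (e t) ∂(weightMeasure w) := by
    rw [L2.inner_def]
    refine integral_congr_ae ?_
    filter_upwards [hf.coeFn_toLp] with t ht
    rw [ht, RCLike.inner_apply]
  rw [h1]
  refine Eq.trans ?_ (integral_withDensity_eq_integral_toReal_smul₀
    hw.1.aemeasurable.ennreal_ofReal (by simp) _).symm
  refine integral_congr_ae ?_
  filter_upwards [hw.2] with t ht
  rw [ENNReal.toReal_ofReal ht.le, Complex.real_smul]
  ring

end density

theorem theorem3p1 (w₀ : ℝ → ℝ) (hw₀ : IsWeight w₀) :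
    ∃ (w : ℝ → ℝ) (lam : ℕ → ℝ) (e : ℕ → ℝ → ℂ),
      IsWeight w ∧ (∀ᵐ t : ℝ, w t ≤ w₀ t) ∧
      StrictMono lam ∧ UniformlyDiscrete lam ∧
      (∀ j : ℕ, MemWeightedL2 w (e j)) ∧
      ∀ f : ℝ → ℂ, MemWeightedL2 w f →
        Tendsto
          (fun N : ℕ => weightedL2Norm w
            (fun t => f t - ∑ j ∈ Finset.range N, weightedInner w f (e j) * expFun (lam j) t))
          atTop (𝓝 0) := by
  obtain ⟨w, hw, hle, hY⟩ := exists_weight_near_one w₀ hw₀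
  have := isFiniteMeasure_weightMeasure hw
  have : Fact ((2 : ℝ≥0∞) ≠ ∞) := ⟨by simp⟩
  have hdense := tailApprox_of_dense_span (x := expLp (weightMeasure w))
    (s := Set.range (expLp (weightMeasure w)))
    (by rintro _ ⟨α, rfl⟩; exact ⟨6, fun ε hε => tailApprox_expLp hY α hε⟩) span_expLp_dense
  obtain ⟨lam, e, hgap, hexp⟩ := exists_expansion_of_tailApprox fun u ε hε => hdense u hε
  refine ⟨w, lam, fun j => e j, hw, hle, fun i j hij => by linarith [hgap i j hij],
    ⟨1, one_pos, fun n m hnm => ?_⟩, fun j => Lp.memLp (e j), fun f hf => ?_⟩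
  · rcases hnm.lt_or_gt with h | h
    · exact le_trans (by linarith [hgap n m h]) (le_abs_self _)
    · rw [abs_sub_comm]
      exact le_trans (by linarith [hgap m n h]) (le_abs_self _)
  · have hlim := tendsto_iff_edist_tendsto_0.1 (hexp (MemLp.toLp f hf))
    refine hlim.congr fun N => ?_
    rw [edist_comm, edist_eq_enorm_sub, Lp.enorm_def, weightedL2Norm]
    refine eLpNorm_congr_ae ?_
    have hterm : ∀ᵐ t ∂(weightMeasure w), ∀ j ∈ Finset.range N,
        (inner ℂ (e j) (MemLp.toLp f hf) • expLp (weightMeasure w) (lam j) : Lp ℂ 2 _) t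
          = weightedInner w f (e j) * expFun (lam j) t := by
      refine (ae_ball_iff (S := (Finset.range N : Set ℕ)) (Finset.countable_toSet _)).2 fun j _ => ?_
      filter_upwards [Lp.coeFn_smul (inner ℂ (e j) (MemLp.toLp f hf))
        (expLp (weightMeasure w) (lam j)), (memLp_expFun (lam j)).coeFn_toLp] with t h1 h2
      rw [h1, Pi.smul_apply, expLp, h2, smul_eq_mul, weightedInner_eq_inner hw hf]
    filter_upwards [hterm, hf.coeFn_toLp, Lp.coeFn_finsetSum (Finset.range N)
        fun j => inner ℂ (e j) (MemLp.toLp f hf) • expLp (weightMeasure w) (lam j),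
      Lp.coeFn_sub (MemLp.toLp f hf) (∑ j ∈ Finset.range N,
        inner ℂ (e j) (MemLp.toLp f hf) • expLp (weightMeasure w) (lam j))] with t h1 h2 h3 h4
    rw [h4, Pi.sub_apply, h2, h3, Finset.sum_apply]
    exact congrArg _ (Finset.sum_congr rfl h1)
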